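/- Let $SG_{2,3}(n)$ ($n\ge 0$) be the generalized two-dimensional Sierpinski gasket with side length $b=3$: the graph $SG_{2,3}(0)$ is an equilateral triangle (three vertices, three edges), and $SG_{2,3}(n+1)$ is built by arranging six translates of $SG_{2,3}(n)$ in three layers of $3$, $2$ and $1$ to form a larger equilateral triangle, where outmost vertices of different translates that fall on the same point are identified. Let $i(n)$, $j(n)$ and $o$ denote the rightmost, topmost and leftmost vertex of $SG_{2,3}(n)$. An orientation of a graph chooses a direction for every edge; it is acyclic if it has no directed cycle. Define - $f_n$: the number of acyclic orientations of $SG_{2,3}(n)$; - $a_n$: the number of those with at least one oriented path from $i(n)$ to $j(n)$, at least one from $j(n)$ to $o$ and at least one from $i(n)$ to $o$; - $b_n$: the number of those with at least one oriented path from $i(n)$ to $j(n)$ and at least one from $i(n)$ to $o$, but no oriented path between $j(n)$ and $o$ (in either direction); - $c_n$: the number of those with at least one oriented path from $i(n)$ to $o$, but no oriented path between $i(n)$ and $j(n)$ and none between $j(n)$ and $o$ (in either direction); - $d_n$: the number of those with no oriented path between any two of $i(n)$, $j(n)$, $o$. Then for every integer $n\ge 0$ the following five identities hold. \[ f_{n+1}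 = f_n^6 - 2(3a_n+2b_n+c_n)^3(501a_n^3 + 1638a_n^2b_n + 1773a_n^2c_n + 297a_n^2d_n + 1755a_nb_n^2 + 3744a_nb_nc_n + 621a_nb_nd_n + 1971a_nc_n^2 + 648a_nc_nd_n + 54a_nd_n^2 + 614b_n^3 + 1929b_n^2c_n + 318b_n^2d_n + 1986b_nc_n^2 + 651b_nc_nd_n + 54b_nd_n^2 + 667c_n^3 + 327c_n^2d_n + 54c_nd_n^2 + 3d_n^3) \] \[ a_{n+1} = 140a_n^6 + 644a_n^5b_n + 588a_n^5c_n + 45a_n^5d_n + 1141a_n^4b_n^2 + 1988a_n^4b_nc_n + 132a_n^4b_nd_n + 812a_n^4c_n^2 + 84a_n^4c_nd_n + 978a_n^3b_n^3 + 2445a_n^3b_n^2c_n + 143a_n^3b_n^2d_n + 1908a_n^3b_nc_n^2 + 176a_n^3b_nc_nd_n + 460a_n^3c_n^3 + 50a_n^3c_n^2d_n + 407a_n^2b_n^4 + 1300a_n^2b_n^3c_n + 68a_n^2b_n^3d_n + 1455a_n^2b_n^2c_n^2 + 122a_n^2b_n^2c_nd_n + 668a_n^2b_nc_n^3 + 68a_n^2b_nc_n^2d_n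 + 104a_n^2c_n^4 + 12a_n^2c_n^3d_n + 66a_nb_n^5 + 253a_nb_n^4c_n + 12a_nb_n^4d_n + 362a_nb_n^3c_n^2 + 28a_nb_n^3c_nd_n + 239a_nb_n^2c_n^3 + 23a_nb_n^2c_n^2d_n + 72a_nb_nc_n^4 + 8a_nb_nc_n^3d_n + 8a_nc_n^5 + a_nc_n^4d_n \] \[ b_{n+1} = 918a_n^6 + 5360a_n^5b_n + 4932a_n^5c_n + 504a_n^5d_n + 12403a_n^4b_n^2 + 21524a_n^4b_nc_n + 1905a_n^4b_nd_n + 8606a_n^4c_n^2 + 1200a_n^4c_nd_n + 14634a_n^3b_n^3 + 35910a_n^3b_n^2c_n + 2786a_n^3b_n^2d_n + 26784a_n^3b_nc_n^2 + 3260a_n^3b_nc_nd_n + 5840a_n^3c_n^3 + 776a_n^3c_n^2d_n + 9338a_n^2b_n^4 + 28846a_n^2b_n^3c_n + 1988a_n^2b_n^3d_n + 30228a_n^2b_n^2c_n^2 + 3284a_n^2b_n^2c_nd_n + 12248a_n^2b_nc_n^3 + 1502a_n^2b_nc_n^2d_n + 1514a_n^2c_n^4 + 192a_n^2c_n^3d_n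 + 3072a_nb_n^5 + 11230a_nb_n^4c_n + 696a_nb_n^4d_n + 14774a_nb_n^3c_n^2 + 1456a_nb_n^3c_nd_n + 8426a_nb_n^2c_n^3 + 962a_nb_n^2c_n^2d_n + 1968a_nb_nc_n^4 + 236a_nb_nc_n^3d_n + 140a_nc_n^5 + 16a_nc_n^4d_n + 409b_n^6 + 1704b_n^5c_n + 96b_n^5d_n + 2652b_n^4c_n^2 + 240b_n^4c_nd_n + 1906b_n^3c_n^3 + 204b_n^3c_n^2d_n + 633b_n^2c_n^4 + 72b_n^2c_n^3d_n + 84b_nc_n^5 + 9b_nc_n^4d_n + 2c_n^6 \] \[ c_{n+1} = 966a_n^6 + 6848a_n^5b_n + 8040a_n^5c_n + 1584a_n^5d_n + 19150a_n^4b_n^2 + 43004a_n^4b_nc_n + 7746a_n^4b_nd_n + 23198a_n^4c_n^2 + 7617a_n^4c_nd_n + 513a_n^4d_n^2 + 27096a_n^3b_n^3 + 87117a_n^3b_n^2c_n + 14345a_n^3b_n^2d_n + 89220a_n^3b_nc_n^2 + 26528a_n^3b_nc_nd_n + 1602a_n^3b_nd_n^2 + 28820a_n^3c_n^3 + 11336a_n^3c_n^2d_n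 + 1152a_n^3c_nd_n^2 + 27a_n^3d_n^3 + 20540a_n^2b_n^4 + 84010a_n^2b_n^3c_n + 12692a_n^2b_n^3d_n + 122577a_n^2b_n^2c_n^2 + 33260a_n^2b_n^2c_nd_n + 1830a_n^2b_n^2d_n^2 + 74852a_n^2b_nc_n^3 + 26816a_n^2b_nc_n^2d_n + 2514a_n^2b_nc_nd_n^2 + 54a_n^2b_nd_n^3 + 15926a_n^2c_n^4 + 6558a_n^2c_n^3d_n + 786a_n^2c_n^2d_n^2 + 27a_n^2c_nd_n^3 + 7950a_nb_n^5 + 38827a_nb_n^4c_n + 5412a_nb_n^4d_n + 71948a_nb_n^3c_n^2 + 17980a_nb_n^3c_nd_n + 912a_nb_n^3d_n^2 + 62663a_nb_n^2c_n^3 + 20741a_nb_n^2c_n^2d_n + 1812a_nb_n^2c_nd_n^2 + 36a_nb_n^2d_n^3 + 25404a_nb_nc_n^4 + 9800a_nb_nc_n^3d_n + 1110a_nb_nc_n^2d_n^2 + 36a_nb_nc_nd_n^3 + 3812a_nc_n^5 + 1624a_nc_n^4d_n + 216a_nc_n^3d_n^2 + 9a_nc_n^2d_n^3 + 1234b_n^6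 + 6924b_n^5c_n + 896b_n^5d_n + 15333b_n^4c_n^2 + 3560b_n^4c_nd_n + 168b_n^4d_n^2 + 17026b_n^3c_n^3 + 5264b_n^3c_n^2d_n + 432b_n^3c_nd_n^2 + 8b_n^3d_n^3 + 9933b_n^2c_n^4 + 3622b_n^2c_n^3d_n + 390b_n^2c_n^2d_n^2 + 12b_n^2c_nd_n^3 + 2880b_nc_n^5 + 1174b_nc_n^4d_n + 150b_nc_n^3d_n^2 + 6b_nc_n^2d_n^3 + 326c_n^6 + 145c_n^5d_n + 21c_n^4d_n^2 + c_n^3d_n^3 \] \[ d_{n+1} = 7458a_n^6 + 60264a_n^5b_n + 75780a_n^5c_n + 17820a_n^5d_n + 195930a_n^4b_n^2 + 482400a_n^4b_nc_n + 108972a_n^4b_nd_n + 292950a_n^4c_n^2 + 128844a_n^4c_nd_n + 13446a_n^4d_n^2 + 328224a_n^3b_n^3 + 1185624a_n^3b_n^2c_n + 257292a_n^3b_n^2d_n + 1406448a_n^3b_nc_n^2 + 593280a_n^3b_nc_nd_n + 59400a_n^3b_nd_n^2 + 547032a_n^3c_n^3 + 335592a_n^3c_n^2d_n + 65016a_n^3c_nd_n^2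 + 3996a_n^3d_n^3 + 299250a_n^2b_n^4 + 1409328a_n^2b_n^3c_n + 294264a_n^2b_n^3d_n + 2449548a_n^2b_n^2c_n^2 + 993708a_n^2b_n^2c_nd_n + 95940a_n^2b_n^2d_n^2 + 1859616a_n^2b_nc_n^3 + 1097496a_n^2b_nc_n^2d_n + 205560a_n^2b_nc_nd_n^2 + 12312a_n^2b_nd_n^3 + 519534a_n^2c_n^4 + 396072a_n^2c_n^3d_n + 108036a_n^2c_n^2d_n^2 + 12636a_n^2c_nd_n^3 + 540a_n^2d_n^4 + 141120a_nb_n^5 + 812700a_nb_n^4c_n + 163728a_nb_n^4d_n + 1841472a_nb_n^3c_n^2 + 721296a_nb_n^3c_nd_n + 67536a_nb_n^3d_n^2 + 2049912a_nb_n^2c_n^3 + 1170180a_nb_n^2c_n^2d_n + 213336a_nb_n^2c_nd_n^2 + 12528a_nb_n^2d_n^3 + 1120104a_nb_nc_n^4 + 828576a_nb_nc_n^3d_n + 221112a_nb_nc_n^2d_n^2 + 25488a_nb_nc_nd_n^3 + 1080a_nb_nd_n^4 + 240228a_nc_n^5 + 216252a_nc_n^4d_n + 75384a_nc_n^3d_n^2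 + 12852a_nc_n^2d_n^3 + 1080a_nc_nd_n^4 + 36a_nd_n^5 + 26974b_n^6 + 182568b_n^5c_n + 35616b_n^5d_n + 506490b_n^4c_n^2 + 192432b_n^4c_nd_n + 17568b_n^4d_n^2 + 736816b_n^3c_n^3 + 409080b_n^3c_n^2d_n + 73008b_n^3c_nd_n^2 + 4224b_n^3d_n^3 + 592746b_n^2c_n^4 + 428100b_n^2c_n^3d_n + 112356b_n^2c_n^2d_n^2 + 12816b_n^2c_nd_n^3 + 540b_n^2d_n^4 + 250176b_nc_n^5 + 220956b_nc_n^4d_n + 76104b_nc_n^3d_n^2 + 12888b_nc_n^2d_n^3 + 1080b_nc_nd_n^4 + 36b_nd_n^5 + 43354c_n^6 + 45132c_n^5d_n + 19206c_n^4d_n^2 + 4308c_n^3d_n^3 + 540c_n^2d_n^4 + 36c_nd_n^5 + d_n^6 \] -/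

import Mathlib

/-- The positions of the constituent triangles when a triangle of side length `b` is cut into `b`
layers of triangles. The point `(x, y)` stands for the point `x • e₁ + y • e₂` of the planar
triangular lattice, where `e₁` is the horizontal unit vector (pointing to the right) and `e₂` is the
unit vector at angle `60°` to it. -/
def sgCopies (b : ℕ) : Finset (ℕ × ℕ) :=
  (Finset.range b ×ˢ Finset.range b).filter (fun s => s.1 + s.2 < b)

/-- The vertices of the generalized two-dimensional Sierpinski gasket `SG_{2,b}(n)`, scaled so that
every edge has length one (the outer triangle then has side length `b ^ n`): stage `0` is a
triangle, and stage `n + 1` is the union of the translates of stage `n` arranged in `b` layers. -/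
def sgVertices (b : ℕ) : ℕ → Finset (ℕ × ℕ)
  | 0 => {(0, 0), (1, 0), (0, 1)}
  | n + 1 => (sgCopies b).biUnion (fun s => (sgVertices b n).image (fun v => b ^ n • s + v))

/-- The edges of `SG_{2,b}(n)`, as a graph on all of the lattice: stage `0` is an equilateral
triangle, and stage `n + 1` is the union of the translates of stage `n` arranged in `b` layers. -/
def sgEdges (b : ℕ) : ℕ → SimpleGraph (ℕ × ℕ)
  | 0 => SimpleGraph.fromEdgeSet {s((0, 0), (1, 0)), s((1, 0), (0, 1)), s((0, 1), (0, 0))}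
  | n + 1 => ⨆ s ∈ sgCopies b, (sgEdges b n).map (addLeftEmbedding (b ^ n • s))

/-- The generalized two-dimensional Sierpinski gasket `SG_{2,b}(n)`. -/
def SG (b n : ℕ) : SimpleGraph (sgVertices b n) :=
  (sgEdges b n).comap Subtype.val

theorem sgLeft_mem (b n : ℕ) [NeZero b] : (0, 0) ∈ sgVertices b n := by
  have hb : 0 < b := Nat.pos_of_ne_zero (NeZero.ne b)
  induction n with
  | zero => simp [sgVertices]
  | succ n ih =>
    simp only [sgVertices, Finset.mem_biUnion, Finset.mem_image]
    exact ⟨(0, 0), by simp [sgCopies, hb], (0, 0), ih, by simp⟩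

theorem sgRight_mem (b n : ℕ) [NeZero b] : (b ^ n, 0) ∈ sgVertices b n := by
  have hb : 0 < b := Nat.pos_of_ne_zero (NeZero.ne b)
  induction n with
  | zero => simp [sgVertices]
  | succ n ih =>
    simp only [sgVertices, Finset.mem_biUnion, Finset.mem_image]
    refine ⟨(b - 1, 0), by simp [sgCopies, hb], (b ^ n, 0), ih, ?_⟩
    obtain ⟨k, rfl⟩ := Nat.exists_eq_succ_of_ne_zero hb.ne'
    simp [pow_succ, Nat.mul_succ]

theorem sgTop_mem (b n : ℕ) [NeZero b] : (0, b ^ n) ∈ sgVertices b n := by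
  have hb : 0 < b := Nat.pos_of_ne_zero (NeZero.ne b)
  induction n with
  | zero => simp [sgVertices]
  | succ n ih =>
    simp only [sgVertices, Finset.mem_biUnion, Finset.mem_image]
    refine ⟨(0, b - 1), by simp [sgCopies, hb], (0, b ^ n), ih, ?_⟩
    obtain ⟨k, rfl⟩ := Nat.exists_eq_succ_of_ne_zero hb.ne'
    simp [pow_succ, Nat.mul_succ]

/-- The leftmost vertex `o`. -/
def sgLeft (b n : ℕ) [NeZero b] : sgVertices b n := ⟨(0, 0), sgLeft_mem b n⟩

/-- The rightmost vertex `i(n)`. -/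
def sgRight (b n : ℕ) [NeZero b] : sgVertices b n := ⟨(b ^ n, 0), sgRight_mem b n⟩

/-- The topmost vertex `j(n)`. -/
def sgTop (b n : ℕ) [NeZero b] : sgVertices b n := ⟨(0, b ^ n), sgTop_mem b n⟩

/-- `D` is an orientation of `G`: every edge of `G` gets exactly one of its two directions, and
`D` has no other arcs. -/
def IsOrientation {V : Type*} (G : SimpleGraph V) (D : Digraph V) : Prop :=
  (∀ u v, G.Adj u v ↔ D.Adj u v ∨ D.Adj v u) ∧ ∀ u v, D.Adj u v → ¬ D.Adj v u

/-- There is an oriented path (with at least one arc) from `u` to `v`. -/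
def HasPath {V : Type*} (D : Digraph V) (u v : V) : Prop :=
  Relation.TransGen D.Adj u v

/-- `D` is an acyclic orientation of `G`, that is, an orientation without directed cycles. -/
def IsAcyclicOrientation {V : Type*} (G : SimpleGraph V) (D : Digraph V) : Prop :=
  IsOrientation G D ∧ ∀ v, ¬ HasPath D v v

/-- There is no oriented path between `u` and `v`, in either direction. -/
def NoPathBetween {V : Type*} (D : Digraph V) (u v : V) : Prop :=
  ¬ HasPath D u v ∧ ¬ HasPath D v u

/-- The number of acyclic orientations of `G`. -/
noncomputable def numAO {V : Type*} (G : SimpleGraph V) : ℕ :=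
  {D : Digraph V | IsAcyclicOrientation G D}.ncard

/-- `f_{2,b}(n)`. -/
noncomputable def sgF (b n : ℕ) : ℕ := numAO (SG b n)

/-- `a_{2,b}(n)`: there are paths `i → j`, `j → o` and `i → o`. -/
noncomputable def sgA (b n : ℕ) [NeZero b] : ℕ :=
  {D : Digraph (sgVertices b n) | IsAcyclicOrientation (SG b n) D ∧
    HasPath D (sgRight b n) (sgTop b n) ∧
    HasPath D (sgTop b n) (sgLeft b n) ∧
    HasPath D (sgRight b n) (sgLeft b n)}.ncard

/-- `b_{2,b}(n)`: there are paths `i → j` and `i → o`, and none between `j` and `o`. -/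
noncomputable def sgB (b n : ℕ) [NeZero b] : ℕ :=
  {D : Digraph (sgVertices b n) | IsAcyclicOrientation (SG b n) D ∧
    HasPath D (sgRight b n) (sgTop b n) ∧
    HasPath D (sgRight b n) (sgLeft b n) ∧
    NoPathBetween D (sgTop b n) (sgLeft b n)}.ncard

/-- `c_{2,b}(n)`: there is a path `i → o`, and none between `i` and `j` or between `j` and `o`. -/
noncomputable def sgC (b n : ℕ) [NeZero b] : ℕ :=
  {D : Digraph (sgVertices b n) | IsAcyclicOrientation (SG b n) D ∧
    HasPath D (sgRight b n) (sgLeft b n) ∧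
    NoPathBetween D (sgRight b n) (sgTop b n) ∧
    NoPathBetween D (sgTop b n) (sgLeft b n)}.ncard

/-- `d_{2,b}(n)`: there is no path between any two of `i`, `j`, `o`. -/
noncomputable def sgD (b n : ℕ) [NeZero b] : ℕ :=
  {D : Digraph (sgVertices b n) | IsAcyclicOrientation (SG b n) D ∧
    NoPathBetween D (sgRight b n) (sgTop b n) ∧
    NoPathBetween D (sgTop b n) (sgLeft b n) ∧
    NoPathBetween D (sgRight b n) (sgLeft b n)}.ncard

/-! The right-hand sides of the recursion relations. The exponents carry their type only to speed up
elaboration. -/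

/-- The polynomial expressing the stage `n + 1` value of `f`. -/
def sgRecF (f a b c d : ℤ) : ℤ :=
  f^(6:ℕ) - 2 * (3*a + 2*b + c)^(3:ℕ) * (501*a^(3:ℕ) + 1638*a^(2:ℕ)*b + 1773*a^(2:ℕ)*c +
    297*a^(2:ℕ)*d + 1755*a*b^(2:ℕ) + 3744*a*b*c + 621*a*b*d + 1971*a*c^(2:ℕ) + 648*a*c*d +
    54*a*d^(2:ℕ) + 614*b^(3:ℕ) + 1929*b^(2:ℕ)*c + 318*b^(2:ℕ)*d + 1986*b*c^(2:ℕ) + 651*b*c*d +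
    54*b*d^(2:ℕ) + 667*c^(3:ℕ) + 327*c^(2:ℕ)*d + 54*c*d^(2:ℕ) + 3*d^(3:ℕ))

/-- The polynomial expressing the stage `n + 1` value of `a`. -/
def sgRecA (a b c d : ℕ) : ℕ :=
  140*a^(6:ℕ) + 644*a^(5:ℕ)*b + 588*a^(5:ℕ)*c + 45*a^(5:ℕ)*d + 1141*a^(4:ℕ)*b^(2:ℕ) +
    1988*a^(4:ℕ)*b*c + 132*a^(4:ℕ)*b*d + 812*a^(4:ℕ)*c^(2:ℕ) + 84*a^(4:ℕ)*c*d +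
    978*a^(3:ℕ)*b^(3:ℕ) + 2445*a^(3:ℕ)*b^(2:ℕ)*c + 143*a^(3:ℕ)*b^(2:ℕ)*d +
    1908*a^(3:ℕ)*b*c^(2:ℕ) + 176*a^(3:ℕ)*b*c*d + 460*a^(3:ℕ)*c^(3:ℕ) + 50*a^(3:ℕ)*c^(2:ℕ)*d +
    407*a^(2:ℕ)*b^(4:ℕ) + 1300*a^(2:ℕ)*b^(3:ℕ)*c + 68*a^(2:ℕ)*b^(3:ℕ)*d +
    1455*a^(2:ℕ)*b^(2:ℕ)*c^(2:ℕ) + 122*a^(2:ℕ)*b^(2:ℕ)*c*d + 668*a^(2:ℕ)*b*c^(3:ℕ) +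
    68*a^(2:ℕ)*b*c^(2:ℕ)*d + 104*a^(2:ℕ)*c^(4:ℕ) + 12*a^(2:ℕ)*c^(3:ℕ)*d + 66*a*b^(5:ℕ) +
    253*a*b^(4:ℕ)*c + 12*a*b^(4:ℕ)*d + 362*a*b^(3:ℕ)*c^(2:ℕ) + 28*a*b^(3:ℕ)*c*d +
    239*a*b^(2:ℕ)*c^(3:ℕ) + 23*a*b^(2:ℕ)*c^(2:ℕ)*d + 72*a*b*c^(4:ℕ) + 8*a*b*c^(3:ℕ)*d +
    8*a*c^(5:ℕ) + a*c^(4:ℕ)*d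

/-- The polynomial expressing the stage `n + 1` value of `b`. -/
def sgRecB (a b c d : ℕ) : ℕ :=
  918*a^(6:ℕ) + 5360*a^(5:ℕ)*b + 4932*a^(5:ℕ)*c + 504*a^(5:ℕ)*d + 12403*a^(4:ℕ)*b^(2:ℕ) +
    21524*a^(4:ℕ)*b*c + 1905*a^(4:ℕ)*b*d + 8606*a^(4:ℕ)*c^(2:ℕ) + 1200*a^(4:ℕ)*c*d +
    14634*a^(3:ℕ)*b^(3:ℕ) + 35910*a^(3:ℕ)*b^(2:ℕ)*c + 2786*a^(3:ℕ)*b^(2:ℕ)*d +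
    26784*a^(3:ℕ)*b*c^(2:ℕ) + 3260*a^(3:ℕ)*b*c*d + 5840*a^(3:ℕ)*c^(3:ℕ) +
    776*a^(3:ℕ)*c^(2:ℕ)*d + 9338*a^(2:ℕ)*b^(4:ℕ) + 28846*a^(2:ℕ)*b^(3:ℕ)*c +
    1988*a^(2:ℕ)*b^(3:ℕ)*d + 30228*a^(2:ℕ)*b^(2:ℕ)*c^(2:ℕ) + 3284*a^(2:ℕ)*b^(2:ℕ)*c*d +
    12248*a^(2:ℕ)*b*c^(3:ℕ) + 1502*a^(2:ℕ)*b*c^(2:ℕ)*d + 1514*a^(2:ℕ)*c^(4:ℕ) +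
    192*a^(2:ℕ)*c^(3:ℕ)*d + 3072*a*b^(5:ℕ) + 11230*a*b^(4:ℕ)*c + 696*a*b^(4:ℕ)*d +
    14774*a*b^(3:ℕ)*c^(2:ℕ) + 1456*a*b^(3:ℕ)*c*d + 8426*a*b^(2:ℕ)*c^(3:ℕ) +
    962*a*b^(2:ℕ)*c^(2:ℕ)*d + 1968*a*b*c^(4:ℕ) + 236*a*b*c^(3:ℕ)*d + 140*a*c^(5:ℕ) +
    16*a*c^(4:ℕ)*d + 409*b^(6:ℕ) + 1704*b^(5:ℕ)*c + 96*b^(5:ℕ)*d + 2652*b^(4:ℕ)*c^(2:ℕ) +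
    240*b^(4:ℕ)*c*d + 1906*b^(3:ℕ)*c^(3:ℕ) + 204*b^(3:ℕ)*c^(2:ℕ)*d + 633*b^(2:ℕ)*c^(4:ℕ) +
    72*b^(2:ℕ)*c^(3:ℕ)*d + 84*b*c^(5:ℕ) + 9*b*c^(4:ℕ)*d + 2*c^(6:ℕ)

/-- The polynomial expressing the stage `n + 1` value of `c`. -/
def sgRecC (a b c d : ℕ) : ℕ :=
  966*a^(6:ℕ) + 6848*a^(5:ℕ)*b + 8040*a^(5:ℕ)*c + 1584*a^(5:ℕ)*d + 19150*a^(4:ℕ)*b^(2:ℕ) +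
    43004*a^(4:ℕ)*b*c + 7746*a^(4:ℕ)*b*d + 23198*a^(4:ℕ)*c^(2:ℕ) + 7617*a^(4:ℕ)*c*d +
    513*a^(4:ℕ)*d^(2:ℕ) + 27096*a^(3:ℕ)*b^(3:ℕ) + 87117*a^(3:ℕ)*b^(2:ℕ)*c +
    14345*a^(3:ℕ)*b^(2:ℕ)*d + 89220*a^(3:ℕ)*b*c^(2:ℕ) + 26528*a^(3:ℕ)*b*c*d +
    1602*a^(3:ℕ)*b*d^(2:ℕ) + 28820*a^(3:ℕ)*c^(3:ℕ) + 11336*a^(3:ℕ)*c^(2:ℕ)*d +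
    1152*a^(3:ℕ)*c*d^(2:ℕ) + 27*a^(3:ℕ)*d^(3:ℕ) + 20540*a^(2:ℕ)*b^(4:ℕ) +
    84010*a^(2:ℕ)*b^(3:ℕ)*c + 12692*a^(2:ℕ)*b^(3:ℕ)*d + 122577*a^(2:ℕ)*b^(2:ℕ)*c^(2:ℕ) +
    33260*a^(2:ℕ)*b^(2:ℕ)*c*d + 1830*a^(2:ℕ)*b^(2:ℕ)*d^(2:ℕ) + 74852*a^(2:ℕ)*b*c^(3:ℕ) +
    26816*a^(2:ℕ)*b*c^(2:ℕ)*d + 2514*a^(2:ℕ)*b*c*d^(2:ℕ) + 54*a^(2:ℕ)*b*d^(3:ℕ) +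
    15926*a^(2:ℕ)*c^(4:ℕ) + 6558*a^(2:ℕ)*c^(3:ℕ)*d + 786*a^(2:ℕ)*c^(2:ℕ)*d^(2:ℕ) +
    27*a^(2:ℕ)*c*d^(3:ℕ) + 7950*a*b^(5:ℕ) + 38827*a*b^(4:ℕ)*c + 5412*a*b^(4:ℕ)*d +
    71948*a*b^(3:ℕ)*c^(2:ℕ) + 17980*a*b^(3:ℕ)*c*d + 912*a*b^(3:ℕ)*d^(2:ℕ) +
    62663*a*b^(2:ℕ)*c^(3:ℕ) + 20741*a*b^(2:ℕ)*c^(2:ℕ)*d + 1812*a*b^(2:ℕ)*c*d^(2:ℕ) +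
    36*a*b^(2:ℕ)*d^(3:ℕ) + 25404*a*b*c^(4:ℕ) + 9800*a*b*c^(3:ℕ)*d + 1110*a*b*c^(2:ℕ)*d^(2:ℕ) +
    36*a*b*c*d^(3:ℕ) + 3812*a*c^(5:ℕ) + 1624*a*c^(4:ℕ)*d + 216*a*c^(3:ℕ)*d^(2:ℕ) +
    9*a*c^(2:ℕ)*d^(3:ℕ) + 1234*b^(6:ℕ) + 6924*b^(5:ℕ)*c + 896*b^(5:ℕ)*d +
    15333*b^(4:ℕ)*c^(2:ℕ) + 3560*b^(4:ℕ)*c*d + 168*b^(4:ℕ)*d^(2:ℕ) + 17026*b^(3:ℕ)*c^(3:ℕ) +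
    5264*b^(3:ℕ)*c^(2:ℕ)*d + 432*b^(3:ℕ)*c*d^(2:ℕ) + 8*b^(3:ℕ)*d^(3:ℕ) + 9933*b^(2:ℕ)*c^(4:ℕ) +
    3622*b^(2:ℕ)*c^(3:ℕ)*d + 390*b^(2:ℕ)*c^(2:ℕ)*d^(2:ℕ) + 12*b^(2:ℕ)*c*d^(3:ℕ) +
    2880*b*c^(5:ℕ) + 1174*b*c^(4:ℕ)*d + 150*b*c^(3:ℕ)*d^(2:ℕ) + 6*b*c^(2:ℕ)*d^(3:ℕ) +
    326*c^(6:ℕ) + 145*c^(5:ℕ)*d + 21*c^(4:ℕ)*d^(2:ℕ) + c^(3:ℕ)*d^(3:ℕ)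

/-- The polynomial expressing the stage `n + 1` value of `d`. -/
def sgRecD (a b c d : ℕ) : ℕ :=
  7458*a^(6:ℕ) + 60264*a^(5:ℕ)*b + 75780*a^(5:ℕ)*c + 17820*a^(5:ℕ)*d + 195930*a^(4:ℕ)*b^(2:ℕ) +
    482400*a^(4:ℕ)*b*c + 108972*a^(4:ℕ)*b*d + 292950*a^(4:ℕ)*c^(2:ℕ) + 128844*a^(4:ℕ)*c*d +
    13446*a^(4:ℕ)*d^(2:ℕ) + 328224*a^(3:ℕ)*b^(3:ℕ) + 1185624*a^(3:ℕ)*b^(2:ℕ)*c +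
    257292*a^(3:ℕ)*b^(2:ℕ)*d + 1406448*a^(3:ℕ)*b*c^(2:ℕ) + 593280*a^(3:ℕ)*b*c*d +
    59400*a^(3:ℕ)*b*d^(2:ℕ) + 547032*a^(3:ℕ)*c^(3:ℕ) + 335592*a^(3:ℕ)*c^(2:ℕ)*d +
    65016*a^(3:ℕ)*c*d^(2:ℕ) + 3996*a^(3:ℕ)*d^(3:ℕ) + 299250*a^(2:ℕ)*b^(4:ℕ) +
    1409328*a^(2:ℕ)*b^(3:ℕ)*c + 294264*a^(2:ℕ)*b^(3:ℕ)*d + 2449548*a^(2:ℕ)*b^(2:ℕ)*c^(2:ℕ) +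
    993708*a^(2:ℕ)*b^(2:ℕ)*c*d + 95940*a^(2:ℕ)*b^(2:ℕ)*d^(2:ℕ) + 1859616*a^(2:ℕ)*b*c^(3:ℕ) +
    1097496*a^(2:ℕ)*b*c^(2:ℕ)*d + 205560*a^(2:ℕ)*b*c*d^(2:ℕ) + 12312*a^(2:ℕ)*b*d^(3:ℕ) +
    519534*a^(2:ℕ)*c^(4:ℕ) + 396072*a^(2:ℕ)*c^(3:ℕ)*d + 108036*a^(2:ℕ)*c^(2:ℕ)*d^(2:ℕ) +
    12636*a^(2:ℕ)*c*d^(3:ℕ) + 540*a^(2:ℕ)*d^(4:ℕ) + 141120*a*b^(5:ℕ) + 812700*a*b^(4:ℕ)*c +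
    163728*a*b^(4:ℕ)*d + 1841472*a*b^(3:ℕ)*c^(2:ℕ) + 721296*a*b^(3:ℕ)*c*d +
    67536*a*b^(3:ℕ)*d^(2:ℕ) + 2049912*a*b^(2:ℕ)*c^(3:ℕ) + 1170180*a*b^(2:ℕ)*c^(2:ℕ)*d +
    213336*a*b^(2:ℕ)*c*d^(2:ℕ) + 12528*a*b^(2:ℕ)*d^(3:ℕ) + 1120104*a*b*c^(4:ℕ) +
    828576*a*b*c^(3:ℕ)*d + 221112*a*b*c^(2:ℕ)*d^(2:ℕ) + 25488*a*b*c*d^(3:ℕ) + 1080*a*b*d^(4:ℕ) +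
    240228*a*c^(5:ℕ) + 216252*a*c^(4:ℕ)*d + 75384*a*c^(3:ℕ)*d^(2:ℕ) + 12852*a*c^(2:ℕ)*d^(3:ℕ) +
    1080*a*c*d^(4:ℕ) + 36*a*d^(5:ℕ) + 26974*b^(6:ℕ) + 182568*b^(5:ℕ)*c + 35616*b^(5:ℕ)*d +
    506490*b^(4:ℕ)*c^(2:ℕ) + 192432*b^(4:ℕ)*c*d + 17568*b^(4:ℕ)*d^(2:ℕ) +
    736816*b^(3:ℕ)*c^(3:ℕ) + 409080*b^(3:ℕ)*c^(2:ℕ)*d + 73008*b^(3:ℕ)*c*d^(2:ℕ) +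
    4224*b^(3:ℕ)*d^(3:ℕ) + 592746*b^(2:ℕ)*c^(4:ℕ) + 428100*b^(2:ℕ)*c^(3:ℕ)*d +
    112356*b^(2:ℕ)*c^(2:ℕ)*d^(2:ℕ) + 12816*b^(2:ℕ)*c*d^(3:ℕ) + 540*b^(2:ℕ)*d^(4:ℕ) +
    250176*b*c^(5:ℕ) + 220956*b*c^(4:ℕ)*d + 76104*b*c^(3:ℕ)*d^(2:ℕ) + 12888*b*c^(2:ℕ)*d^(3:ℕ) +
    1080*b*c*d^(4:ℕ) + 36*b*d^(5:ℕ) + 43354*c^(6:ℕ) + 45132*c^(5:ℕ)*d + 19206*c^(4:ℕ)*d^(2:ℕ) +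
    4308*c^(3:ℕ)*d^(3:ℕ) + 540*c^(2:ℕ)*d^(4:ℕ) + 36*c*d^(5:ℕ) + d^(6:ℕ)

/-! Different copies of stage `n` share no edge and meet only in corners. An acyclic orientation of
stage `n + 1` is therefore a choice of acyclic orientations of the six copies. Whether their union
has a cycle, and which outer corners reach which, depends only on the strict orders that
reachability induces on the corners of each copy. There are nineteen such orders, of four types, and
a, b, c, d count the orientations for one representative of each type. `IsDistribution n w` says
that every order of type `t` arises from exactly `w t` orientations. No symmetry argument is needed
for this uniformity: it is carried along by the induction, because the computation treats all
nineteen orders of the outer corners. Everything reduces to `IsDistribution.succ`, that is, to the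
passage from `w` to `recPoly w`.

The combinatorial half glues the copies one at a time. It suffices to remember reachability between
the few slots that still matter. The new relation comes from the old one and the order of the new
corners by Warshall's algorithm, with only the shared slots as pivots (`IsGluing.transGen_iff`,
`IsGluing.acyclic_iff`). By `IsGluingChain.ncard_extensions` the number of orientations is then the
value of the recursion `Gluing.extCount`, on relations coded as bit masks.

The algebraic half, `extCount_sixCopies`, evaluates this recursion for arbitrary weights. It is a
homogeneous sextic polynomial in the four weights, with natural coefficients of sum at most 19^6 <
2^26. With X = 2^26, the value at the weights 1, X, X^7, X^49 has the coefficients as its digits in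
base X, so one numerical evaluation (`multiplicity_run_sixCopies`) proves the polynomial identity.
Since f = 6a + 6b + 6c + d, the recursion for f then follows by algebra (`sgRecF_eq`). -/

/-! ### Strict orders on the three corners, and the gluing of six copies -/

/-- The nineteen strict orders on the three corners (`0` right, `1` top, `2` left), as lists of
pairs, with their types: `0` a chain, `1` a vee or a wedge, `2` a single pair, `3` an antichain. -/
def cornerOrders : List (List (Fin 3 × Fin 3) × Fin 4) :=
  [([(0, 1), (1, 2), (0, 2)], 0), ([(0, 2), (2, 1), (0, 1)], 0), ([(1, 0), (0, 2), (1, 2)], 0),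
   ([(1, 2), (2, 0), (1, 0)], 0), ([(2, 0), (0, 1), (2, 1)], 0), ([(2, 1), (1, 0), (2, 0)], 0),
   ([(0, 1), (0, 2)], 1), ([(1, 0), (1, 2)], 1), ([(2, 0), (2, 1)], 1),
   ([(1, 0), (2, 0)], 1), ([(0, 1), (2, 1)], 1), ([(0, 2), (1, 2)], 1),
   ([(0, 1)], 2), ([(1, 0)], 2), ([(0, 2)], 2), ([(2, 0)], 2), ([(1, 2)], 2), ([(2, 1)], 2),
   ([], 3)]

/-- The gluing of one more triangle: the slots of its right, top and left corner, those among them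
that are in use already, and the slots that are needed later on. -/
structure Gluing where
  right : ℕ
  top : ℕ
  left : ℕ
  shared : List ℕ
  live : List ℕ

namespace Gluing

/-- The slot of a corner. -/
def corner (s : Gluing) : Fin 3 → ℕ := ![s.right, s.top, s.left]

/-- A relation on ten slots as a bit mask: bit `10 * u + v` stands for the pair `(u, v)`. -/
def relCode (l : List (ℕ × ℕ)) : ℕ :=
  l.foldr (fun e m => Nat.lor m (2 ^ (10 * e.1 + e.2))) 0

/-- The code of an order on the corners. -/
def orderCode (s : Gluing) (q : List (Fin 3 × Fin 3)) : ℕ :=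
  relCode (q.map fun e => (s.corner e.1, s.corner e.2))

/-- The bit mask of all pairs of slots from a list. -/
def pairMask (l : List ℕ) : ℕ := relCode (l ×ˢ l)

/-- The mask of the diagonal. -/
def diagMask : ℕ := relCode ((List.range 10).map fun u => (u, u))

/-- One step of Warshall's algorithm: add all pairs `(u, v)` for which `(u, k)` and `(k, v)` are
there. The literal has the bits `10 * u`, for `u < 10`. -/
def pivot (k m : ℕ) : ℕ :=
  Nat.lor m (Nat.mul (Nat.land (Nat.shiftRight m k) 1239150146850664126585242625)
    (Nat.land (Nat.shiftRight m (Nat.mul 10 k)) 1023))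

/-- The steps of Warshall's algorithm for a list of slots. -/
def pivots : List ℕ → ℕ → ℕ
  | [], m => m
  | k :: l, m => pivots l (pivot k m)

/-- The relation after the gluing of a triangle with a given order of its corners, before
restriction to the slots needed later on. -/
def closure (s : Gluing) (m : ℕ) (q : List (Fin 3 × Fin 3)) : ℕ :=
  pivots s.shared (Nat.lor m (s.orderCode q))

/-- The weighted number of ways to glue more triangles to a relation `m` such that there are no
cycles and the final relation is `target`. -/
def extCount (w : Fin 4 → ℕ) (target : ℕ) : List Gluing → ℕ → ℕ
  | [], m => bif Nat.beq m target then 1 else 0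
  | s :: l, m => (cornerOrders.map fun q => w q.2 *
      bif Nat.beq (Nat.land (s.closure m q.1) diagMask) 0 then
        extCount w target l (Nat.land (s.closure m q.1) (pairMask s.live)) else 0).sum

/-- The gluing of the six copies. The slots `0`, `1`, `2` are the outer corners. -/
def sixCopies : List Gluing :=
  -- The bottom row from left to right, the middle row from right to left, then the top. A slot
  -- other than an outer corner stops being live after the last triangle that has it as a corner, so
  -- at most five slots are live at any time.
  [⟨3, 5, 0, [], [0, 3, 5]⟩, ⟨4, 6, 3, [3], [0, 4, 5, 6]⟩, ⟨1, 7, 4, [4], [0, 1, 5, 6, 7]⟩,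
   ⟨7, 9, 6, [6, 7], [0, 1, 5, 6, 9]⟩, ⟨6, 8, 5, [5, 6], [0, 1, 8, 9]⟩,
   ⟨9, 2, 8, [8, 9], [0, 1, 2]⟩]

/-- The outer triangle. -/
def outer : Gluing := ⟨1, 2, 0, [], []⟩

/-! ### Tables of relations with multiplicities -/

/-- Merge two sorted tables, adding the multiplicities of equal relations. -/
noncomputable def merge (S : List (ℕ × ℕ)) : List (ℕ × ℕ) → List (ℕ × ℕ) :=
  -- Nested recursors, the outer one producing a function of the second table, reduce directly in
  -- the kernel.
  List.rec (motive := fun _ => List (ℕ × ℕ) → List (ℕ × ℕ)) (fun T => T)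
    (fun x S ihS => List.rec (motive := fun _ => List (ℕ × ℕ)) (x :: S) (fun y T ihT =>
      Bool.rec (Bool.rec (y :: ihT) (x :: ihS (y :: T)) (Nat.ble x.1 y.1))
        ((x.1, Nat.add x.2 y.2) :: ihS T) (Nat.beq x.1 y.1))) S

/-- Merge the first table with the second, the third with the fourth, and so on. -/
noncomputable def mergePairs : List (List (ℕ × ℕ)) → List (List (ℕ × ℕ))
  | S :: T :: l => merge S T :: mergePairs l
  | l => l

/-- Merge all tables, after `n` rounds of merging in pairs. -/
noncomputable def mergeAll : ℕ → List (List (ℕ × ℕ)) → List (ℕ × ℕ)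
  | 0, l => l.foldr merge []
  | n + 1, l => mergeAll n (mergePairs l)

/-- The results of gluing a triangle to the relation `m` with multiplicity `c`. The list `ps` has
the codes of the orders of its corners, with weights. -/
noncomputable def expand (shared : List ℕ) (mask : ℕ) (ps : List (ℕ × ℕ)) (m c : ℕ) :
    List (ℕ × ℕ) :=
  ps.foldr (fun p S => (fun r => Bool.rec S (merge [(Nat.land r mask, Nat.mul c p.2)] S)
    (Nat.beq (Nat.land r diagMask) 0)) (pivots shared (Nat.lor m p.1))) []

/-- The table of the relations that arise from a table by gluing. -/
noncomputable def run (w : Fin 4 → ℕ) : List Gluing → List (ℕ × ℕ) → List (ℕ × ℕ)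
  | [], S => S
  -- Ten rounds leave a single table if there are at most 1024. Correctness holds for any number of
  -- rounds.
  | s :: l, S => run w l (mergeAll 10 (S.map fun x => expand s.shared (pairMask s.live)
      (cornerOrders.map fun q => (s.orderCode q.1, w q.2)) x.1 x.2))

/-- The multiplicity of a relation in a table. -/
def multiplicity (target : ℕ) (S : List (ℕ × ℕ)) : ℕ :=
  (S.map fun x => bif Nat.beq x.1 target then x.2 else 0).sum

end Gluing

/-- The right-hand sides of the recursion, by type. -/
def recPoly (w : Fin 4 → ℕ) : Fin 4 → ℕ :=
  ![sgRecA (w 0) (w 1) (w 2) (w 3), sgRecB (w 0) (w 1) (w 2) (w 3),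
    sgRecC (w 0) (w 1) (w 2) (w 3), sgRecD (w 0) (w 1) (w 2) (w 3)]

/-- The exponents of the Kronecker substitution. -/
def kroneckerExponent : Fin 4 → ℕ := ![0, 1, 7, 49]

/-- The weights of the Kronecker substitution. -/
def kroneckerWeight (t : Fin 4) : ℕ := (2 ^ 26) ^ kroneckerExponent t

/-- The one large computation. Merging equal relations after every gluing avoids the enumeration of
all sextuples of orders, and the Kronecker weights pack a whole polynomial into each multiplicity.
-/
theorem multiplicity_run_sixCopies :
    (cornerOrders.all fun q => Nat.beq (Gluing.multiplicity (Gluing.outer.orderCode q.1)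
      (Gluing.run kroneckerWeight Gluing.sixCopies [(0, 1)])) (recPoly kroneckerWeight q.2)) =
    true := by
  decide +kernel

/-! ### Correctness of the tables, and the count as a polynomial in the weights. -/

namespace Gluing

/-- The pairing of a table with a function on relations. -/
def weigh (g : ℕ → ℕ) (S : List (ℕ × ℕ)) : ℕ := (S.map fun x => x.2 * g x.1).sum

@[simp] theorem weigh_nil (g : ℕ → ℕ) : weigh g [] = 0 := rfl

@[simp] theorem weigh_cons (g : ℕ → ℕ) (x : ℕ × ℕ) (S : List (ℕ × ℕ)) :
    weigh g (x :: S) = x.2 * g x.1 + weigh g S := by simp [weigh]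

theorem merge_nil_left (T : List (ℕ × ℕ)) : merge [] T = T := rfl

theorem merge_nil_right (x : ℕ × ℕ) (S : List (ℕ × ℕ)) : merge (x :: S) [] = x :: S := rfl

theorem merge_cons_cons (x y : ℕ × ℕ) (S T : List (ℕ × ℕ)) :
    merge (x :: S) (y :: T) =
      if x.1 = y.1 then (x.1, x.2 + y.2) :: merge S T
      else if x.1 ≤ y.1 then x :: merge S (y :: T) else y :: merge (x :: S) T := by
  have h : merge (x :: S) (y :: T) = Bool.rec (motive := fun _ => List (ℕ × ℕ))
      (Bool.rec (motive := fun _ => List (ℕ × ℕ)) (y :: merge (x :: S) T)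
        (x :: merge S (y :: T)) (Nat.ble x.1 y.1))
      ((x.1, x.2 + y.2) :: merge S T) (Nat.beq x.1 y.1) := rfl
  rw [h]
  rcases hb : Nat.beq x.1 y.1 with _ | _
  · have h1 : x.1 ≠ y.1 := Nat.ne_of_beq_eq_false hb
    rw [if_neg h1]
    rcases hc : Nat.ble x.1 y.1 with _ | _
    · rw [if_neg (fun h => by simp [Nat.ble_eq_true_of_le h] at hc)]
    · rw [if_pos (Nat.le_of_ble_eq_true hc)]
  · rw [if_pos (Nat.eq_of_beq_eq_true hb)]

theorem weigh_merge (g : ℕ → ℕ) (S T : List (ℕ × ℕ)) :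
    weigh g (merge S T) = weigh g S + weigh g T := by
  induction S generalizing T with
  | nil => simp [merge_nil_left]
  | cons x S ihS =>
    induction T with
    | nil => simp [merge_nil_right]
    | cons y T ihT =>
      rw [merge_cons_cons]
      split_ifs with h1 h2
      · simp [ihS, h1]; ring
      · simp [ihS]; ring
      · simp only [weigh_cons, ihT]; ring

theorem sum_weigh_mergePairs (g : ℕ → ℕ) (l : List (List (ℕ × ℕ))) :
    ((mergePairs l).map (weigh g)).sum = (l.map (weigh g)).sum := by
  induction l using mergePairs.induct with
  | case1 S T l ih => simp [mergePairs, ih, weigh_merge, add_assoc]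
  | case2 l h => rw [mergePairs]; exact h

theorem weigh_mergeAll (g : ℕ → ℕ) (n : ℕ) (l : List (List (ℕ × ℕ))) :
    weigh g (mergeAll n l) = (l.map (weigh g)).sum := by
  induction n generalizing l with
  | zero =>
    rw [mergeAll]
    induction l with
    | nil => simp
    | cons S l ih => simp [weigh_merge, ih]
  | succ n ih => rw [mergeAll, ih, sum_weigh_mergePairs]

theorem weigh_expand (g : ℕ → ℕ) (shared : List ℕ) (mask : ℕ) (ps : List (ℕ × ℕ)) (m c : ℕ) :
    weigh g (expand shared mask ps m c) = c * (ps.map fun p => p.2 *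
      bif Nat.beq (Nat.land (pivots shared (Nat.lor m p.1)) diagMask) 0 then
        g (Nat.land (pivots shared (Nat.lor m p.1)) mask) else 0).sum := by
  induction ps with
  | nil => simp [expand]
  | cons p ps ih =>
    have h : expand shared mask (p :: ps) m c = Bool.rec (motive := fun _ => List (ℕ × ℕ))
        (expand shared mask ps m c)
        (merge [(Nat.land (pivots shared (Nat.lor m p.1)) mask, c * p.2)]
          (expand shared mask ps m c))
        (Nat.beq (Nat.land (pivots shared (Nat.lor m p.1)) diagMask) 0) := rfl
    rw [h, List.map_cons, List.sum_cons]
    rcases Nat.beq (Nat.land (pivots shared (Nat.lor m p.1)) diagMask) 0 with _ | _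
    · simp [ih]
    · simp [ih, weigh_merge]; ring

/-- With respect to the pairing `weigh`, gluing a triangle to a table is the adjoint of one step of
the recursion `extCount`. The forward computation on tables and the backward recursion therefore
give the same number. -/
theorem weigh_run (w : Fin 4 → ℕ) (target : ℕ) (l : List Gluing) (S : List (ℕ × ℕ)) :
    multiplicity target (run w l S) = weigh (extCount w target l) S := by
  induction l generalizing S with
  | nil =>
    rw [run, multiplicity, weigh]
    refine congrArg List.sum (List.map_congr_left fun x _ => ?_)
    rw [extCount]
    cases Nat.beq x.1 target <;> simp
  | cons s l ih =>
    rw [run, ih, weigh_mergeAll, List.map_map, weigh]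
    refine congrArg List.sum (List.map_congr_left fun x _ => ?_)
    rw [Function.comp_apply, weigh_expand, List.map_map, extCount]
    rfl

/-- The lists of types of the triangles in the gluings counted by `extCount`. -/
def extPaths (target : ℕ) : List Gluing → ℕ → List (List (Fin 4))
  | [], m => bif Nat.beq m target then [[]] else []
  | s :: l, m => cornerOrders.flatMap fun q =>
      bif Nat.beq (Nat.land (s.closure m q.1) diagMask) 0 then
        (extPaths target l (Nat.land (s.closure m q.1) (pairMask s.live))).map (q.2 :: ·) else []

/-- The admissible gluings do not depend on the weights. This exhibits the count as a sum of
monomials, one for each gluing. -/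
theorem extCount_eq_sum_extPaths (w : Fin 4 → ℕ) (target : ℕ) (l : List Gluing) (m : ℕ) :
    extCount w target l m = ((extPaths target l m).map fun ts => (ts.map w).prod).sum := by
  induction l generalizing m with
  | nil => rw [extCount, extPaths]; cases Nat.beq m target <;> simp
  | cons s l ih =>
    rw [extCount, extPaths, List.flatMap_def, List.map_flatten, List.sum_flatten, List.map_map,
      List.map_map]
    congr 1
    refine List.map_congr_left fun q _ => ?_
    simp only [Function.comp_apply]
    rcases Nat.beq (Nat.land (s.closure m q.1) diagMask) 0 with _ | _
    · simp
    · simp [ih, List.map_map, Function.comp_def, List.sum_map_mul_left]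

theorem length_of_mem_extPaths (target : ℕ) (l : List Gluing) (m : ℕ) :
    ∀ ts ∈ extPaths target l m, ts.length = l.length := by
  induction l generalizing m with
  | nil => rw [extPaths]; cases Nat.beq m target <;> simp
  | cons s l ih =>
    intro ts hts
    rw [extPaths, List.mem_flatMap] at hts
    obtain ⟨q, -, hts⟩ := hts
    rcases hb : Nat.beq (Nat.land (s.closure m q.1) diagMask) 0 with _ | _
    · simp only [hb, cond_false, List.not_mem_nil] at hts
    · simp only [hb, cond_true, List.mem_map] at hts
      obtain ⟨ts', h, rfl⟩ := hts
      simp [ih _ _ h]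

/-- Each triangle has nineteen possible orders. The bound controls the sum of the coefficients,
hence the base of the Kronecker substitution. -/
theorem length_extPaths_le (target : ℕ) (l : List Gluing) (m : ℕ) :
    (extPaths target l m).length ≤ 19 ^ l.length := by
  induction l generalizing m with
  | nil => rw [extPaths]; cases Nat.beq m target <;> simp
  | cons s l ih =>
    rw [extPaths, List.length_flatMap]
    calc _ ≤ (cornerOrders.map fun _ => 19 ^ l.length).sum := by
          refine List.sum_le_sum fun q _ => ?_
          rcases Nat.beq (Nat.land (s.closure m q.1) diagMask) 0 with _ | _
          · simp
          · simpa using ih _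
      _ = 19 ^ (s :: l).length := by
          rw [List.map_const', List.sum_replicate, List.length_cons, pow_succ']
          rfl

end Gluing

/-! ### Kronecker substitution -/

/-- Collecting equal powers turns multiplicities into digits in base `X`. They are genuine digits
once the multiset has fewer than `X` elements. -/
theorem sum_map_pow_eq_ofDigits (X N : ℕ) (M : Multiset ℕ) (hN : ∀ e ∈ M, e < N) :
    (M.map (X ^ ·)).sum = Nat.ofDigits X ((List.range N).map M.count) := by
  have h1 : ∀ (f : ℕ → ℕ) (n : ℕ),
      Nat.ofDigits X ((List.range n).map f) = ∑ k ∈ Finset.range n, f k * X ^ k := by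
    intro f n
    induction n with
    | zero => simp
    | succ n ih =>
      rw [List.range_succ, List.map_append, Nat.ofDigits_append, ih, Finset.sum_range_succ]
      simp [mul_comm]
  rw [h1, Finset.sum_multiset_map_count]
  refine Finset.sum_subset_zero_on_sdiff (fun e he => ?_) (fun e he => ?_) (fun e _ => by simp)
  · exact Finset.mem_range.2 (hN e (Multiset.mem_toFinset.1 he))
  · rw [Finset.mem_sdiff, Multiset.mem_toFinset] at he
    simp [Multiset.count_eq_zero_of_notMem he.2]

/-- A multiset of exponents with fewer than `X` elements is determined by its sum of powers. -/
theorem eq_of_sum_map_pow_eq {X : ℕ} (hX : 1 < X) {M M' : Multiset ℕ} (hM : M.card < X)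
    (hM' : M'.card < X) (h : (M.map (X ^ ·)).sum = (M'.map (X ^ ·)).sum) : M = M' := by
  obtain ⟨N, hN⟩ : ∃ N, ∀ e ∈ M + M', e < N :=
    ⟨(M + M').sum + 1, fun e he => Nat.lt_succ_of_le (Multiset.le_sum_of_mem he)⟩
  rw [sum_map_pow_eq_ofDigits X N M (fun e he => hN e (by simp [he])),
    sum_map_pow_eq_ofDigits X N M' (fun e he => hN e (by simp [he]))] at h
  have h2 := Nat.ofDigits_inj_of_len_eq hX (by simp)
    (by simpa using fun a _ => (Multiset.count_le_card a M).trans_lt hM)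
    (by simpa using fun a _ => (Multiset.count_le_card a M').trans_lt hM') h
  ext e
  by_cases he : e < N
  · exact List.map_inj_left.1 h2 e (List.mem_range.2 he)
  · rw [Multiset.count_eq_zero_of_notMem fun h => he (hN e (by simp [h])),
      Multiset.count_eq_zero_of_notMem fun h => he (hN e (by simp [h]))]

/-- The monomial of degree six whose Kronecker substitution has exponent `e`. -/
def sexticMonomial (w : Fin 4 → ℕ) (e : ℕ) : ℕ :=
  w 0 ^ (6 - (e % 7 + e / 7 % 7 + e / 49)) * w 1 ^ (e % 7) * w 2 ^ (e / 7 % 7) * w 3 ^ (e / 49)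

theorem sexticMonomial_kroneckerWeight (e : ℕ) :
    sexticMonomial kroneckerWeight e = (2 ^ 26) ^ e := by
  have h : e = e % 7 + 7 * (e / 7 % 7) + 49 * (e / 49) := by omega
  conv_rhs => rw [h]
  simp only [sexticMonomial, kroneckerWeight, kroneckerExponent, ← pow_mul, ← pow_add,
    Matrix.cons_val]
  congr 1
  ring

/-- No type occurs more than six times, so the counts of the types 1, 2, 3 are the base 7 digits of
the exponent. The count of type 0 is what remains of the six, which is why its Kronecker exponent
can be zero. -/
theorem prod_map_eq_sexticMonomial (w : Fin 4 → ℕ) (ts : List (Fin 4)) (hts : ts.length = 6) :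
    (ts.map w).prod = sexticMonomial w (ts.map kroneckerExponent).sum := by
  have h1 : (ts.map w).prod =
      w 0 ^ ts.count 0 * w 1 ^ ts.count 1 * w 2 ^ ts.count 2 * w 3 ^ ts.count 3 := by
    rw [Finset.prod_list_map_count, ← Fin.prod_univ_four fun t => w t ^ ts.count t]
    exact Finset.prod_subset (Finset.subset_univ _) fun t _ ht => by
      rw [List.count_eq_zero_of_not_mem (by simpa using ht), pow_zero]
  have h2 : (ts.map kroneckerExponent).sum =
      ts.count 1 + 7 * ts.count 2 + 49 * ts.count 3 := by
    clear hts h1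
    induction ts with
    | nil => rfl
    | cons t ts ih =>
      rw [List.map_cons, List.sum_cons, ih]
      fin_cases t <;> simp [kroneckerExponent] <;> ring
  have h3 : ts.count 0 + ts.count 1 + ts.count 2 + ts.count 3 = 6 := by
    clear h1 h2
    rw [← hts]
    clear hts
    induction ts with
    | nil => rfl
    | cons t ts ih =>
      rw [List.length_cons, ← ih]
      fin_cases t <;> simp <;> ring
  rw [h1, h2, sexticMonomial]
  generalize ts.count 0 = n₀, ts.count 1 = n₁, ts.count 2 = n₂, ts.count 3 = n₃ at h3 ⊢
  have e1 : (n₁ + 7 * n₂ + 49 * n₃) % 7 = n₁ := by omega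
  have e2 : (n₁ + 7 * n₂ + 49 * n₃) / 7 % 7 = n₂ := by omega
  have e3 : (n₁ + 7 * n₂ + 49 * n₃) / 49 = n₃ := by omega
  rw [e1, e2, e3, ← h3, Nat.add_assoc n₀, Nat.add_assoc n₀, Nat.add_sub_cancel]

/-! ### The right-hand sides as multisets of exponents. -/

/-- The coefficients of `sgRecA`, with the exponents of the Kronecker substitution. -/
def recTermsA : List (ℕ × ℕ) :=
  [(140, 0), (644, 1), (588, 7), (45, 49), (1141, 2), (1988, 8), (132, 50), (812, 14), (84, 56),
   (978, 3), (2445, 9), (143, 51), (1908, 15), (176, 57), (460, 21), (50, 63), (407, 4),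
   (1300, 10), (68, 52), (1455, 16), (122, 58), (668, 22), (68, 64), (104, 28), (12, 70),
   (66, 5), (253, 11), (12, 53), (362, 17), (28, 59), (239, 23), (23, 65), (72, 29), (8, 71),
   (8, 35), (1, 77)]

/-- The coefficients of `sgRecB`, with the exponents of the Kronecker substitution. -/
def recTermsB : List (ℕ × ℕ) :=
  [(918, 0), (5360, 1), (4932, 7), (504, 49), (12403, 2), (21524, 8), (1905, 50), (8606, 14),
   (1200, 56), (14634, 3), (35910, 9), (2786, 51), (26784, 15), (3260, 57), (5840, 21),
   (776, 63), (9338, 4), (28846, 10), (1988, 52), (30228, 16), (3284, 58), (12248, 22),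
   (1502, 64), (1514, 28), (192, 70), (3072, 5), (11230, 11), (696, 53), (14774, 17), (1456, 59),
   (8426, 23), (962, 65), (1968, 29), (236, 71), (140, 35), (16, 77), (409, 6), (1704, 12),
   (96, 54), (2652, 18), (240, 60), (1906, 24), (204, 66), (633, 30), (72, 72), (84, 36),
   (9, 78), (2, 42)]

/-- The coefficients of `sgRecC`, with the exponents of the Kronecker substitution. -/
def recTermsC : List (ℕ × ℕ) :=
  [(966, 0), (6848, 1), (8040, 7), (1584, 49), (19150, 2), (43004, 8), (7746, 50), (23198, 14),
   (7617, 56), (513, 98), (27096, 3), (87117, 9), (14345, 51), (89220, 15), (26528, 57),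
   (1602, 99), (28820, 21), (11336, 63), (1152, 105), (27, 147), (20540, 4), (84010, 10),
   (12692, 52), (122577, 16), (33260, 58), (1830, 100), (74852, 22), (26816, 64), (2514, 106),
   (54, 148), (15926, 28), (6558, 70), (786, 112), (27, 154), (7950, 5), (38827, 11), (5412, 53),
   (71948, 17), (17980, 59), (912, 101), (62663, 23), (20741, 65), (1812, 107), (36, 149),
   (25404, 29), (9800, 71), (1110, 113), (36, 155), (3812, 35), (1624, 77), (216, 119), (9, 161),
   (1234, 6), (6924, 12), (896, 54), (15333, 18), (3560, 60), (168, 102), (17026, 24),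
   (5264, 66), (432, 108), (8, 150), (9933, 30), (3622, 72), (390, 114), (12, 156), (2880, 36),
   (1174, 78), (150, 120), (6, 162), (326, 42), (145, 84), (21, 126), (1, 168)]

/-- The coefficients of `sgRecD`, with the exponents of the Kronecker substitution. -/
def recTermsD : List (ℕ × ℕ) :=
  [(7458, 0), (60264, 1), (75780, 7), (17820, 49), (195930, 2), (482400, 8), (108972, 50),
   (292950, 14), (128844, 56), (13446, 98), (328224, 3), (1185624, 9), (257292, 51),
   (1406448, 15), (593280, 57), (59400, 99), (547032, 21), (335592, 63), (65016, 105),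
   (3996, 147), (299250, 4), (1409328, 10), (294264, 52), (2449548, 16), (993708, 58),
   (95940, 100), (1859616, 22), (1097496, 64), (205560, 106), (12312, 148), (519534, 28),
   (396072, 70), (108036, 112), (12636, 154), (540, 196), (141120, 5), (812700, 11),
   (163728, 53), (1841472, 17), (721296, 59), (67536, 101), (2049912, 23), (1170180, 65),
   (213336, 107), (12528, 149), (1120104, 29), (828576, 71), (221112, 113), (25488, 155),
   (1080, 197), (240228, 35), (216252, 77), (75384, 119), (12852, 161), (1080, 203), (36, 245),
   (26974, 6), (182568, 12), (35616, 54), (506490, 18), (192432, 60), (17568, 102), (736816, 24),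
   (409080, 66), (73008, 108), (4224, 150), (592746, 30), (428100, 72), (112356, 114),
   (12816, 156), (540, 198), (250176, 36), (220956, 78), (76104, 120), (12888, 162), (1080, 204),
   (36, 246), (43354, 42), (45132, 84), (19206, 126), (4308, 168), (540, 210), (36, 252),
   (1, 294)]

theorem sgRecA_eq_sum_recTerms (w : Fin 4 → ℕ) : sgRecA (w 0) (w 1) (w 2) (w 3) =
    (recTermsA.map fun x => x.1 * sexticMonomial w x.2).sum := by
  simp only [recTermsA, sgRecA, sexticMonomial, List.map_cons, List.map_nil, List.sum_cons,
    List.sum_nil, Nat.reduceMod, Nat.reduceDiv, Nat.reduceAdd, Nat.reduceSub, pow_zero, mul_one]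
  ring

theorem sgRecB_eq_sum_recTerms (w : Fin 4 → ℕ) : sgRecB (w 0) (w 1) (w 2) (w 3) =
    (recTermsB.map fun x => x.1 * sexticMonomial w x.2).sum := by
  simp only [recTermsB, sgRecB, sexticMonomial, List.map_cons, List.map_nil, List.sum_cons,
    List.sum_nil, Nat.reduceMod, Nat.reduceDiv, Nat.reduceAdd, Nat.reduceSub, pow_zero, mul_one]
  ring

theorem sgRecC_eq_sum_recTerms (w : Fin 4 → ℕ) : sgRecC (w 0) (w 1) (w 2) (w 3) =
    (recTermsC.map fun x => x.1 * sexticMonomial w x.2).sum := by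
  simp only [recTermsC, sgRecC, sexticMonomial, List.map_cons, List.map_nil, List.sum_cons,
    List.sum_nil, Nat.reduceMod, Nat.reduceDiv, Nat.reduceAdd, Nat.reduceSub, pow_zero, mul_one]
  ring

theorem sgRecD_eq_sum_recTerms (w : Fin 4 → ℕ) : sgRecD (w 0) (w 1) (w 2) (w 3) =
    (recTermsD.map fun x => x.1 * sexticMonomial w x.2).sum := by
  simp only [recTermsD, sgRecD, sexticMonomial, List.map_cons, List.map_nil, List.sum_cons,
    List.sum_nil, Nat.reduceMod, Nat.reduceDiv, Nat.reduceAdd, Nat.reduceSub, pow_zero, mul_one]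
  ring

/-- The coefficients and exponents of the right-hand sides of the recursion, by type. -/
def recTerms : Fin 4 → List (ℕ × ℕ) := ![recTermsA, recTermsB, recTermsC, recTermsD]

theorem recPoly_eq_sum_recTerms (w : Fin 4 → ℕ) :
    ∀ t, recPoly w t = ((recTerms t).map fun x => x.1 * sexticMonomial w x.2).sum
  | 0 => sgRecA_eq_sum_recTerms w
  | 1 => sgRecB_eq_sum_recTerms w
  | 2 => sgRecC_eq_sum_recTerms w
  | 3 => sgRecD_eq_sum_recTerms w

/-- The exponents in a list of terms, with multiplicities. -/
def termExponents (l : List (ℕ × ℕ)) : Multiset ℕ :=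
  (l.map fun x => Multiset.replicate x.1 x.2).sum

theorem sum_map_termExponents (f : ℕ → ℕ) (l : List (ℕ × ℕ)) :
    ((termExponents l).map f).sum = (l.map fun x => x.1 * f x.2).sum := by
  rw [termExponents]
  induction l with
  | nil => simp
  | cons x l ih => simp [ih]

theorem card_termExponents (l : List (ℕ × ℕ)) :
    (termExponents l).card = (l.map Prod.fst).sum := by
  rw [termExponents]
  induction l with
  | nil => simp
  | cons x l ih => simp [ih]

/-- The claimed polynomials also need a coefficient sum below the base, so that no carries occur on
either side of the comparison. -/
theorem card_recTerms_lt : ∀ t, (termExponents (recTerms t)).card < 2 ^ 26 := by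
  simp only [card_termExponents]
  decide +kernel

/-- The weighted number of ways to glue six triangles with a given order of the outer corners. -/
theorem extCount_sixCopies (w : Fin 4 → ℕ) {q : List (Fin 3 × Fin 3) × Fin 4}
    (hq : q ∈ cornerOrders) :
    Gluing.extCount w (Gluing.outer.orderCode q.1) Gluing.sixCopies 0 = recPoly w q.2 := by
  set P := Gluing.extPaths (Gluing.outer.orderCode q.1) Gluing.sixCopies 0 with hP
  have hlen : ∀ ts ∈ P, ts.length = 6 := Gluing.length_of_mem_extPaths _ _ _
  have hcount : ∀ w, Gluing.extCount w (Gluing.outer.orderCode q.1) Gluing.sixCopies 0 =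
      (((P.map fun ts => (ts.map kroneckerExponent).sum : List ℕ) : Multiset ℕ).map
        (sexticMonomial w)).sum := by
    intro w
    rw [Gluing.extCount_eq_sum_extPaths, Multiset.map_coe, Multiset.sum_coe, List.map_map]
    exact congrArg List.sum (List.map_congr_left fun ts hts =>
      prod_map_eq_sexticMonomial w ts (hlen ts hts))
  have hkron : Gluing.extCount kroneckerWeight (Gluing.outer.orderCode q.1) Gluing.sixCopies 0 =
      recPoly kroneckerWeight q.2 := by
    have h := Nat.eq_of_beq_eq_true (List.all_eq_true.1 multiplicity_run_sixCopies q hq)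
    rw [Gluing.weigh_run] at h
    simpa using h
  -- Equality at the Kronecker weights forces equality of the multisets of exponents, and hence
  -- equality at all weights.
  have hexp : ((P.map fun ts => (ts.map kroneckerExponent).sum : List ℕ) : Multiset ℕ) =
      termExponents (recTerms q.2) := by
    refine eq_of_sum_map_pow_eq (X := 2 ^ 26) (by norm_num) ?_ (card_recTerms_lt _) ?_
    · rw [Multiset.coe_card, List.length_map]
      -- Here 19^6 = 47045881 < 2^26 = 67108864, which explains the base.
      exact (Gluing.length_extPaths_le _ _ _).trans_lt (by norm_num [Gluing.sixCopies])
    · simp only [← sexticMonomial_kroneckerWeight]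
      rw [← hcount, hkron, recPoly_eq_sum_recTerms, sum_map_termExponents]
  rw [hcount, hexp, sum_map_termExponents, ← recPoly_eq_sum_recTerms]

/-! ### Relations given by codes -/

namespace Gluing

/-- `m` is the code of the restriction of `R` to the ten slots. -/
def Represents (m : ℕ) (R : ℕ → ℕ → Prop) : Prop :=
  ∀ i, m.testBit i = true ↔ ∃ u v, u < 10 ∧ v < 10 ∧ R u v ∧ i = 10 * u + v

theorem Represents.testBit {m : ℕ} {R : ℕ → ℕ → Prop} (h : Represents m R) {u v : ℕ} (hu : u < 10)
    (hv : v < 10) : m.testBit (10 * u + v) = true ↔ R u v := by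
  rw [h]
  constructor
  · rintro ⟨u', v', hu', hv', hR, h⟩
    obtain rfl : u = u' := by omega
    obtain rfl : v = v' := by omega
    exact hR
  · exact fun hR => ⟨u, v, hu, hv, hR, rfl⟩

theorem Represents.congr {m : ℕ} {R R' : ℕ → ℕ → Prop} (h : Represents m R)
    (hR : ∀ u v, u < 10 → v < 10 → (R u v ↔ R' u v)) : Represents m R' := by
  intro i
  rw [h]
  constructor <;> rintro ⟨u, v, hu, hv, hr, rfl⟩
  · exact ⟨u, v, hu, hv, (hR u v hu hv).1 hr, rfl⟩
  · exact ⟨u, v, hu, hv, (hR u v hu hv).2 hr, rfl⟩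

/-- A code has no bits besides those of pairs of slots below ten, so comparing relations is
comparing numbers. -/
theorem Represents.eq_iff {m m' : ℕ} {R R' : ℕ → ℕ → Prop} (h : Represents m R)
    (h' : Represents m' R') : m = m' ↔ ∀ u v, u < 10 → v < 10 → (R u v ↔ R' u v) := by
  constructor
  · rintro rfl u v hu hv
    rw [← h.testBit hu hv, h'.testBit hu hv]
  · intro hR
    refine Nat.eq_of_testBit_eq fun i => ?_
    rw [Bool.eq_iff_iff, h.congr hR i, h' i]

theorem represents_zero : Represents 0 fun _ _ => False := by
  intro i
  simp

theorem represents_relCode (l : List (ℕ × ℕ)) (hl : ∀ e ∈ l, e.1 < 10 ∧ e.2 < 10) :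
    Represents (relCode l) fun u v => (u, v) ∈ l := by
  intro i
  have h : (relCode l).testBit i = true ↔ ∃ e ∈ l, i = 10 * e.1 + e.2 := by
    clear hl
    induction l with
    | nil => simp [relCode]
    | cons e l ih =>
      rw [show relCode (e :: l) = relCode l ||| 2 ^ (10 * e.1 + e.2) from rfl, Nat.testBit_or,
        Nat.testBit_two_pow, Bool.or_eq_true, ih]
      simp [or_comm, eq_comm]
  rw [h]
  constructor
  · rintro ⟨e, he, rfl⟩
    exact ⟨e.1, e.2, (hl e he).1, (hl e he).2, he, rfl⟩
  · rintro ⟨u, v, -, -, he, rfl⟩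
    exact ⟨(u, v), he, rfl⟩

theorem Represents.lor {m m' : ℕ} {R R' : ℕ → ℕ → Prop} (h : Represents m R)
    (h' : Represents m' R') : Represents (Nat.lor m m') fun u v => R u v ∨ R' u v := by
  intro i
  rw [show Nat.lor m m' = m ||| m' from rfl, Nat.testBit_or, Bool.or_eq_true, h i, h' i]
  constructor
  · rintro (⟨u, v, hu, hv, hR, rfl⟩ | ⟨u, v, hu, hv, hR, rfl⟩)
    · exact ⟨u, v, hu, hv, Or.inl hR, rfl⟩
    · exact ⟨u, v, hu, hv, Or.inr hR, rfl⟩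
  · rintro ⟨u, v, hu, hv, hR | hR, rfl⟩
    · exact Or.inl ⟨u, v, hu, hv, hR, rfl⟩
    · exact Or.inr ⟨u, v, hu, hv, hR, rfl⟩

theorem Represents.land {m m' : ℕ} {R R' : ℕ → ℕ → Prop} (h : Represents m R)
    (h' : Represents m' R') : Represents (Nat.land m m') fun u v => R u v ∧ R' u v := by
  intro i
  rw [show Nat.land m m' = m &&& m' from rfl, Nat.testBit_and, Bool.and_eq_true]
  constructor
  · rintro ⟨h1, h2⟩
    obtain ⟨u, v, hu, hv, hR, rfl⟩ := (h i).1 h1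
    exact ⟨u, v, hu, hv, ⟨hR, (h'.testBit hu hv).1 h2⟩, rfl⟩
  · rintro ⟨u, v, hu, hv, hR, rfl⟩
    exact ⟨(h.testBit hu hv).2 hR.1, (h'.testBit hu hv).2 hR.2⟩

theorem Represents.land_pairMask {m : ℕ} {R : ℕ → ℕ → Prop} (h : Represents m R) {l : List ℕ}
    (hl : ∀ u ∈ l, u < 10) :
    Represents (Nat.land m (pairMask l)) fun u v => R u v ∧ u ∈ l ∧ v ∈ l :=
  (h.land (represents_relCode _ fun _ he =>
    ⟨hl _ (List.mem_product.1 he).1, hl _ (List.mem_product.1 he).2⟩)).congr fun u v _ _ => by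
      rw [List.mem_product]

theorem Represents.land_diagMask {m : ℕ} {R : ℕ → ℕ → Prop} (h : Represents m R) :
    Nat.beq (Nat.land m diagMask) 0 = true ↔ ∀ u < 10, ¬ R u u := by
  have hd : Represents diagMask fun u v => (u, v) ∈ (List.range 10).map fun u => (u, u) :=
    represents_relCode _ (by decide)
  rw [Nat.beq_eq, (h.land hd).eq_iff represents_zero]
  simp only [iff_false, not_and, List.mem_map, List.mem_range, Prod.mk.injEq, not_exists]
  constructor
  · intro H u hu hR
    exact H u u hu hu hR u hu rfl rfl
  · rintro H u v hu hv hR w hw rfl rfl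
    exact H w hw hR

/-- `A` has bits only at multiples of ten and `row` fits into ten bits. The product therefore places
a copy of `row` in each block of ten marked by `A`, and no carries occur. The induction on `u`
strips the lowest block. -/
theorem testBit_mul_row {row : ℕ} (hrow : row < 2 ^ 10) {v : ℕ} (hv : v < 10) (u A : ℕ)
    (hA : ∀ i, A.testBit i = true → 10 ∣ i) :
    (A * row).testBit (10 * u + v) = (A.testBit (10 * u) && row.testBit v) := by
  have h0 : ∀ A : ℕ, (∀ i, A.testBit i = true → 10 ∣ i) →
      A % 2 ^ 10 = (A.testBit 0).toNat := by
    intro A hA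
    refine Nat.eq_of_testBit_eq fun i => ?_
    rw [Nat.testBit_mod_two_pow]
    rcases Nat.eq_zero_or_pos i with rfl | hi
    · cases A.testBit 0 <;> simp
    · have h1 : (decide (i < 10) && A.testBit i) = false := by
        by_contra h
        simp only [Bool.not_eq_false, Bool.and_eq_true, decide_eq_true_eq] at h
        have := Nat.le_of_dvd hi (hA i h.2)
        omega
      rw [h1]
      cases A.testBit 0
      · simp
      · rw [Bool.toNat_true, ← pow_zero 2, Nat.testBit_two_pow]
        simpa using hi.ne
  have hsplit : ∀ A : ℕ, A * row = 2 ^ 10 * (A / 2 ^ 10 * row) + A % 2 ^ 10 * row := by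
    intro A
    conv_lhs => rw [← Nat.div_add_mod A (2 ^ 10)]
    ring
  have hlt : ∀ A : ℕ, (∀ i, A.testBit i = true → 10 ∣ i) → A % 2 ^ 10 * row < 2 ^ 10 := by
    intro A hA
    rw [h0 A hA]
    cases A.testBit 0
    · simp
    · simpa using hrow
  induction u generalizing A with
  | zero =>
    rw [hsplit, Nat.testBit_two_pow_mul_add _ (hlt A hA), if_pos (by omega), h0 A hA]
    cases A.testBit 0 <;> simp
  | succ u ih =>
    rw [hsplit, Nat.testBit_two_pow_mul_add _ (hlt A hA), if_neg (by omega),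
      show 10 * (u + 1) + v - 10 = 10 * u + v by omega, ih, Nat.testBit_div_two_pow,
      show 10 * (u + 1) = 10 * u + 10 by ring]
    intro i hi
    rw [Nat.testBit_div_two_pow] at hi
    have := hA _ hi
    omega

theorem Represents.pivot {m : ℕ} {R : ℕ → ℕ → Prop} (h : Represents m R) {k : ℕ} (hk : k < 10) :
    Represents (pivot k m) fun u v => R u v ∨ (R u k ∧ R k v) := by
  -- The literal is the sum of 2^(10u) over u < 10, the mask of column 0. Shifting by `k` moves
  -- column `k` there.
  have hc : Represents 1239150146850664126585242625 fun u v => v = 0 := by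
    refine Represents.congr (R := fun u v => (u, v) ∈ (List.range 10).map fun u => (u, 0)) ?_ ?_
    · exact represents_relCode ((List.range 10).map fun u => (u, 0)) (by decide)
    · intro u v hu hv
      simp only [List.mem_map, List.mem_range, Prod.mk.injEq]
      exact ⟨fun ⟨_, _, _, h⟩ => h.symm, fun h => ⟨u, hu, rfl, h.symm⟩⟩
  intro i
  obtain ⟨u, v, hv, rfl⟩ : ∃ u v, v < 10 ∧ i = 10 * u + v :=
    ⟨i / 10, i % 10, Nat.mod_lt _ (by norm_num), by omega⟩
  have hrow : (m >>> (10 * k)) &&& 1023 < 2 ^ 10 := Nat.and_lt_two_pow _ (by norm_num)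
  have hcol : ∀ i, ((m >>> k) &&& 1239150146850664126585242625).testBit i = true → 10 ∣ i := by
    intro i hi
    rw [Nat.testBit_and, Bool.and_eq_true] at hi
    obtain ⟨u, v, -, -, rfl, rfl⟩ := (hc i).1 hi.2
    exact ⟨u, rfl⟩
  rw [show Gluing.pivot k m = m ||| ((m >>> k) &&& 1239150146850664126585242625) *
      ((m >>> (10 * k)) &&& 1023) from rfl, Nat.testBit_or, Bool.or_eq_true,
    testBit_mul_row hrow hv u _ hcol, Bool.and_eq_true, Nat.testBit_and, Nat.testBit_and,
    Bool.and_eq_true, Bool.and_eq_true, Nat.testBit_shiftRight, Nat.testBit_shiftRight,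
    h.testBit hk hv, show (1023 : ℕ) = 2 ^ 10 - 1 by norm_num, Nat.testBit_two_pow_sub_one]
  constructor
  · rintro (h1 | ⟨⟨h1, h2⟩, h3, -⟩)
    · obtain ⟨u', v', hu', hv', hR, he⟩ := (h _).1 h1
      exact ⟨u', v', hu', hv', Or.inl hR, he⟩
    · obtain ⟨u', v', hu', -, rfl, he⟩ := (hc _).1 h2
      obtain rfl : u = u' := by omega
      rw [add_comm, h.testBit hu' hk] at h1
      exact ⟨u, v, hu', hv, Or.inr ⟨h1, h3⟩, rfl⟩
  · rintro ⟨u', v', hu', hv', hR, he⟩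
    obtain rfl : u = u' := by omega
    obtain rfl : v = v' := by omega
    rcases hR with hR | ⟨h1, h2⟩
    · exact Or.inl ((h.testBit hu' hv).2 hR)
    · refine Or.inr ⟨⟨?_, ?_⟩, h2, by simpa using hv⟩
      · rwa [add_comm, h.testBit hu' hk]
      · simpa using (hc.testBit (v := 0) hu' (by norm_num)).2 rfl

/-! ### Warshall's algorithm on abstract relations. -/

/-- Warshall's algorithm on relations. -/
def pivotsRel {S : Type*} : List S → (S → S → Prop) → S → S → Prop
  | [], R => R
  | k :: l, R => pivotsRel l fun u v => R u v ∨ (R u k ∧ R k v)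

theorem Represents.pivots {l : List ℕ} (hl : ∀ k ∈ l, k < 10) {m : ℕ} {R : ℕ → ℕ → Prop}
    (h : Represents m R) : Represents (pivots l m) (pivotsRel l R) := by
  induction l generalizing m R with
  | nil => exact h
  | cons k l ih =>
    exact ih (fun j hj => hl j (List.mem_cons_of_mem _ hj)) (h.pivot (hl k List.mem_cons_self))

theorem subrelation_pivotsRel {S : Type*} (l : List S) {R : S → S → Prop} {u v : S}
    (h : R u v) : pivotsRel l R u v := by
  induction l generalizing R with
  | nil => exact h
  | cons k l ih => exact ih (Or.inl h)

theorem transGen_of_pivotsRel {S : Type*} (l : List S) {R : S → S → Prop} {u v : S}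
    (h : pivotsRel l R u v) : Relation.TransGen R u v := by
  induction l generalizing R with
  | nil => exact .single h
  | cons k l ih =>
    refine Relation.TransGen.trans_induction_on (ih h) ?_ fun _ _ h1 h2 => h1.trans h2
    rintro a b (hR | ⟨h1, h2⟩)
    · exact .single hR
    · exact .tail (.single h1) h2

/-- The result of Warshall's algorithm is transitive at the pivots, and at all places at which the
relation is transitive from the start. -/
theorem pivotsRel_trans {S : Type*} (l : List S) {R : S → S → Prop}
    (hR : ∀ u k v, k ∉ l → R u k → R k v → R u v) {u k v : S} (h1 : pivotsRel l R u k)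
    (h2 : pivotsRel l R k v) : pivotsRel l R u v := by
  induction l generalizing R with
  | nil => exact hR u k v List.not_mem_nil h1 h2
  | cons j l ih =>
    refine ih (fun u k v hk h1 h2 => ?_) h1 h2
    by_cases hkj : k = j
    · subst hkj
      rcases h1 with h1 | ⟨h1, -⟩ <;> rcases h2 with h2 | ⟨-, h2⟩ <;> exact Or.inr ⟨h1, h2⟩
    · have hk' : k ∉ j :: l := by simp [hkj, hk]
      rcases h1 with h1 | ⟨h1, h1'⟩ <;> rcases h2 with h2 | ⟨h2, h2'⟩
      · exact Or.inl (hR u k v hk' h1 h2)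
      · exact Or.inr ⟨hR u k j hk' h1 h2, h2'⟩
      · exact Or.inr ⟨h1, hR j k v hk' h1' h2⟩
      · exact Or.inr ⟨h1, h2'⟩

end Gluing

open Relation

/-! ### Paths in a union of relations with few common vertices -/

/-- The relations `A k` live on the sets `W k`, two of which meet only in the vertices `t u` with
`u ∈ T`. The slots `L k` stand for some of the vertices in `W k`, among them the common ones. -/
structure IsGluing {ι S V : Type*} (A : ι → V → V → Prop) (W : ι → Set V) (t : S → V)
    (L : ι → List S) (T : List S) : Prop where
  supp : ∀ k x y, A k x y → x ∈ W k ∧ y ∈ W k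
  inj : ∀ k l, ∀ u ∈ L k, ∀ v ∈ L l, t u = t v → u = v
  mem : ∀ k, ∀ u ∈ L k, t u ∈ W k
  sub : ∀ k, ∀ u ∈ T, u ∈ L k
  inter : ∀ k l, k ≠ l → ∀ x ∈ W k, x ∈ W l → ∃ u ∈ T, t u = x

namespace IsGluing

variable {ι S V : Type*} {A : ι → V → V → Prop} {W : ι → Set V} {t : S → V} {L : ι → List S}
  {T : List S}

/-- The reachability relation between the slots in one part. -/
def partRel (A : ι → V → V → Prop) (t : S → V) (L : ι → List S) (u v : S) : Prop :=
  ∃ k, u ∈ L k ∧ v ∈ L k ∧ TransGen (A k) (t u) (t v)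

theorem supp_transGen (h : IsGluing A W t L T) {k : ι} {x y : V} (hxy : TransGen (A k) x y) :
    x ∈ W k ∧ y ∈ W k := by
  induction hxy with
  | single h1 => exact h.supp k _ _ h1
  | tail _ h1 ih => exact ⟨ih.1, (h.supp k _ _ h1).2⟩

theorem mem_of_mem (h : IsGluing A W t L T) {k l : ι} {u : S} (hu : u ∈ L k) (hk : t u ∈ W l) :
    u ∈ L l := by
  by_cases hkl : k = l
  · exact hkl ▸ hu
  · obtain ⟨v, hv, hvu⟩ := h.inter k l hkl _ (h.mem k u hu) hk
    rw [← h.inj k k v (h.sub k v hv) u hu hvu]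
    exact h.sub l v hv

/-- A slot that is not common lies in one part only, so both paths run in that part and compose
there. This is why the common slots suffice as pivots. -/
theorem partRel_trans (h : IsGluing A W t L T) {u s v : S} (hs : s ∉ T)
    (h1 : partRel A t L u s) (h2 : partRel A t L s v) : partRel A t L u v := by
  obtain ⟨k, hu, hs1, h1⟩ := h1
  obtain ⟨l, hs2, hv, h2⟩ := h2
  obtain rfl : k = l := by
    by_contra hkl
    obtain ⟨v, hv, hvs⟩ := h.inter k l hkl _ (h.mem k s hs1) (h.mem l s hs2)
    exact hs (h.inj k k v (h.sub k v hv) s hs1 hvs ▸ hv)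
  exact ⟨k, hu, hv, h1.trans h2⟩

theorem transGen_of_partRel {u v : S} (h : partRel A t L u v) :
    TransGen (fun x y => ∃ k, A k x y) (t u) (t v) := by
  obtain ⟨k, -, -, h⟩ := h
  exact TransGen.mono (fun _ _ h => ⟨k, h⟩) _ _ h

theorem transGen_of_pivotsRel {u v : S} (h : Gluing.pivotsRel T (partRel A t L) u v) :
    TransGen (fun x y => ∃ k, A k x y) (t u) (t v) :=
  TransGen.trans_induction_on (Gluing.transGen_of_pivotsRel T h) transGen_of_partRel
    fun _ _ h1 h2 => h1.trans h2

/-- Every path in the union that starts at a slot is a path between slots, followed by a path in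
one of the parts. -/
theorem exists_last_part (h : IsGluing A W t L T) {l : ι} {u : S} (hu : u ∈ L l) {y : V}
    (hy : TransGen (fun x y => ∃ k, A k x y) (t u) y) :
    ∃ k, ∃ s ∈ L k, (s = u ∨ Gluing.pivotsRel T (partRel A t L) u s) ∧
      TransGen (A k) (t s) y := by
  induction hy with
  | single h1 =>
    obtain ⟨k, h1⟩ := h1
    exact ⟨k, u, h.mem_of_mem hu (h.supp k _ _ h1).1, Or.inl rfl, .single h1⟩
  | @tail y z _ h1 ih =>
    obtain ⟨m, h1⟩ := h1
    obtain ⟨k, s, hs, hus, hsy⟩ := ih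
    by_cases hkm : k = m
    · subst hkm
      exact ⟨k, s, hs, hus, hsy.tail h1⟩
    -- The new arc changes parts, so `y` is a common slot. The path so far is recorded as a path
    -- between slots, and the last part starts afresh at `y`.
    · obtain ⟨v, hv, rfl⟩ := h.inter k m hkm y (h.supp_transGen hsy).2 (h.supp m _ _ h1).1
      refine ⟨m, v, h.sub m v hv, Or.inr ?_, .single h1⟩
      have hsv : Gluing.pivotsRel T (partRel A t L) s v :=
        Gluing.subrelation_pivotsRel T ⟨k, hs, h.sub k v hv, hsy⟩
      rcases hus with rfl | hus
      · exact hsv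
      · exact Gluing.pivotsRel_trans T (fun _ _ _ => h.partRel_trans) hus hsv

/-- Reachability in the union is found by Warshall's algorithm. -/
theorem transGen_iff (h : IsGluing A W t L T) {k l : ι} {u v : S} (hu : u ∈ L k) (hv : v ∈ L l) :
    TransGen (fun x y => ∃ k, A k x y) (t u) (t v) ↔
      Gluing.pivotsRel T (partRel A t L) u v := by
  refine ⟨fun huv => ?_, transGen_of_pivotsRel⟩
  obtain ⟨m, s, hs, hus, hsv⟩ := h.exists_last_part hu huv
  have hsv' : Gluing.pivotsRel T (partRel A t L) s v :=
    Gluing.subrelation_pivotsRel T ⟨m, hs, h.mem_of_mem hv (h.supp_transGen hsv).2, hsv⟩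
  rcases hus with rfl | hus
  · exact hsv'
  · exact Gluing.pivotsRel_trans T (fun _ _ _ => h.partRel_trans) hus hsv'

/-- A path can change parts only at a common slot. One of the two halves has an arc, so a cycle of
the union that is not inside one part can be rotated to a nontrivial cycle based at a slot. -/
theorem exists_common_of_transGen (h : IsGluing A W t L T) {x y : V}
    (hxy : TransGen (fun x y => ∃ k, A k x y) x y) :
    (∃ k, TransGen (A k) x y) ∨ ∃ s ∈ T, ReflTransGen (fun x y => ∃ k, A k x y) x (t s) ∧
      ReflTransGen (fun x y => ∃ k, A k x y) (t s) y ∧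
      (TransGen (fun x y => ∃ k, A k x y) x (t s) ∨
        TransGen (fun x y => ∃ k, A k x y) (t s) y) := by
  induction hxy with
  | single h1 =>
    obtain ⟨k, h1⟩ := h1
    exact Or.inl ⟨k, .single h1⟩
  | @tail y z hxy h1 ih =>
    obtain ⟨m, h1⟩ := h1
    rcases ih with ⟨k, hk⟩ | ⟨s, hs, hxs, hsy, -⟩
    · by_cases hkm : k = m
      · subst hkm
        exact Or.inl ⟨k, hk.tail h1⟩
      · obtain ⟨v, hv, rfl⟩ := h.inter k m hkm y (h.supp_transGen hk).2 (h.supp m _ _ h1).1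
        exact Or.inr ⟨v, hv, hxy.to_reflTransGen, .single ⟨m, h1⟩, Or.inl hxy⟩
    · exact Or.inr ⟨s, hs, hxs, hsy.tail ⟨m, h1⟩, Or.inr (.tail' hsy ⟨m, h1⟩)⟩

/-- The union has no cycle if and only if the parts have none, and Warshall's algorithm finds
none. -/
theorem acyclic_iff (h : IsGluing A W t L T) [Nonempty ι] :
    (∀ x, ¬ TransGen (fun x y => ∃ k, A k x y) x x) ↔
      (∀ k x, ¬ TransGen (A k) x x) ∧ ∀ u, ¬ Gluing.pivotsRel T (partRel A t L) u u := by
  constructor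
  · exact fun hx => ⟨fun k x hk => hx x (TransGen.mono (fun _ _ h => ⟨k, h⟩) _ _ hk),
      fun u hu => hx _ (transGen_of_pivotsRel hu)⟩
  · rintro ⟨h1, h2⟩ x hx
    rcases h.exists_common_of_transGen hx with ⟨k, hk⟩ | ⟨s, hs, hxs, hsx, hxs' | hsx'⟩
    · exact h1 k x hk
    · have k := Classical.arbitrary ι
      exact h2 s ((h.transGen_iff (h.sub k s hs) (h.sub k s hs)).1 (.trans_right hsx hxs'))
    · have k := Classical.arbitrary ι
      exact h2 s ((h.transGen_iff (h.sub k s hs) (h.sub k s hs)).1 (.trans_left hsx' hxs))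

end IsGluing

/-! ### Acyclic orientations of a union of graphs -/

section Orientations

variable {V : Type*}

/-- The arcs of `D` along the edges of `G`. -/
def Digraph.restrictTo (D : Digraph V) (G : SimpleGraph V) : Digraph V :=
  ⟨fun u v => D.Adj u v ∧ G.Adj u v⟩

theorem IsOrientation.restrictTo {G H : SimpleGraph V} {D : Digraph V} (h : IsOrientation G D)
    (hH : H ≤ G) : IsOrientation H (D.restrictTo H) := by
  refine ⟨fun u v => ⟨fun huv => ?_, ?_⟩, fun u v h1 h2 => h.2 u v h1.1 h2.1⟩
  · exact ((h.1 u v).1 (hH huv)).imp (fun h => ⟨h, huv⟩) fun h => ⟨h, huv.symm⟩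
  · rintro (h | h)
    · exact h.2
    · exact h.2.symm

theorem IsAcyclicOrientation.restrictTo {G H : SimpleGraph V} {D : Digraph V}
    (h : IsAcyclicOrientation G D) (hH : H ≤ G) : IsAcyclicOrientation H (D.restrictTo H) :=
  ⟨h.1.restrictTo hH, fun v hv => h.2 v (TransGen.mono (fun _ _ h => h.1) _ _ hv)⟩

theorem IsOrientation.adj {G : SimpleGraph V} {D : Digraph V} (h : IsOrientation G D) {u v : V}
    (huv : D.Adj u v) : G.Adj u v :=
  (h.1 u v).2 (Or.inl huv)

theorem IsOrientation.restrictTo_self {G : SimpleGraph V} {D : Digraph V}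
    (h : IsOrientation G D) : D.restrictTo G = D := by
  ext u v
  exact ⟨fun h => h.1, fun huv => ⟨huv, h.adj huv⟩⟩

theorem IsOrientation.sup {G H : SimpleGraph V} {D E : Digraph V} (hD : IsOrientation G D)
    (hE : IsOrientation H E) (hGH : ∀ u v, G.Adj u v → ¬ H.Adj u v) :
    IsOrientation (G ⊔ H) (D ⊔ E) := by
  refine ⟨fun u v => ?_, ?_⟩
  · rw [SimpleGraph.sup_adj, hD.1, hE.1, Digraph.sup_adj, Digraph.sup_adj]
    tauto
  · rintro u v (h1 | h1) (h2 | h2)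
    · exact hD.2 u v h1 h2
    · exact hGH u v (hD.adj h1) (hE.adj h2).symm
    · exact hGH u v (hD.adj h2).symm (hE.adj h1)
    · exact hE.2 u v h1 h2

/-- As the graphs share no edge, each arc of `D₁ ⊔ D₂` is attributed to one of them, and the two
conditions separate. -/
theorem restrictTo_sup_eq_iff {G H : SimpleGraph V} {D D₁ D₂ : Digraph V}
    (h₁ : IsOrientation G D₁) (h₂ : IsOrientation H D₂)
    (hGH : ∀ u v, G.Adj u v → ¬ H.Adj u v) :
    D.restrictTo (G ⊔ H) = D₁ ⊔ D₂ ↔ D.restrictTo G = D₁ ∧ D.restrictTo H = D₂ := by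
  constructor
  · intro h
    have h' : ∀ u v, (D.Adj u v ∧ (G.Adj u v ∨ H.Adj u v)) ↔ (D₁.Adj u v ∨ D₂.Adj u v) :=
      fun u v => by
        have := congrArg (fun E : Digraph V => E.Adj u v) h
        exact this.to_iff
    constructor
    · ext u v
      have := h' u v
      have := hGH u v
      have := @h₁.adj _ _ _ u v
      have := @h₂.adj _ _ _ u v
      change D.Adj u v ∧ G.Adj u v ↔ _
      tauto
    · ext u v
      have := h' u v
      have := hGH u v
      have := @h₁.adj _ _ _ u v
      have := @h₂.adj _ _ _ u v
      change D.Adj u v ∧ H.Adj u v ↔ _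
      tauto
  · rintro ⟨rfl, rfl⟩
    ext u v
    exact and_or_left

theorem finite_setOf_isAcyclicOrientation {G : SimpleGraph V}
    (hG : {e : V × V | G.Adj e.1 e.2}.Finite) : {D | IsAcyclicOrientation G D}.Finite := by
  refine Set.Finite.of_finite_image (f := fun D : Digraph V => {e : V × V | D.Adj e.1 e.2})
    (hG.finite_subsets.subset ?_) ?_
  · rintro _ ⟨D, hD, rfl⟩ e he
    exact hD.1.adj he
  · intro D _ E _ h
    ext u v
    exact Set.ext_iff.1 h (u, v)

/-! ### The order of the corners -/

/-- The reachability relation between the corners is given by the list `q`. -/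
def HasOrder (D : Digraph V) (c : Fin 3 → V) (q : List (Fin 3 × Fin 3)) : Prop :=
  ∀ a b, HasPath D (c a) (c b) ↔ (a, b) ∈ q

/-- Reachability in an acyclic digraph is irreflexive and transitive. Completeness of the list is
checked over all Boolean 3 × 3 matrices. -/
theorem exists_mem_cornerOrders {D : Digraph V} (hD : ∀ v, ¬ HasPath D v v) (c : Fin 3 → V) :
    ∃ q ∈ cornerOrders, HasOrder D c q.1 := by
  classical
  have key : ∀ f : Fin 3 → Fin 3 → Bool, (∀ a, f a a = false) →
      (∀ a b c, f a b = true → f b c = true → f a c = true) →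
      ∃ q ∈ cornerOrders, ∀ a b, f a b = true ↔ (a, b) ∈ q.1 := by decide +kernel
  obtain ⟨q, hq, h⟩ := key (fun a b => decide (HasPath D (c a) (c b)))
    (fun a => by simpa using hD (c a))
    (fun a b d h1 h2 => decide_eq_true ((of_decide_eq_true h1).trans (of_decide_eq_true h2)))
  exact ⟨q, hq, fun a b => by rw [← h a b, decide_eq_true_eq]⟩

theorem HasOrder.unique {D : Digraph V} {c : Fin 3 → V}
    {q q' : List (Fin 3 × Fin 3) × Fin 4} (hq : q ∈ cornerOrders) (hq' : q' ∈ cornerOrders)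
    (h : HasOrder D c q.1) (h' : HasOrder D c q'.1) : q = q' := by
  have key : ∀ q ∈ cornerOrders, ∀ q' ∈ cornerOrders,
      (∀ a b, (a, b) ∈ q.1 ↔ (a, b) ∈ q'.1) → q = q' := by decide +kernel
  exact key q hq q' hq' fun a b => (h a b).symm.trans (h' a b)

/-- Sums over acyclic digraphs of functions that only depend on the order of the corners. -/
theorem sum_eq_sum_cornerOrders (A : Finset (Digraph V)) (hA : ∀ D ∈ A, ∀ v, ¬ HasPath D v v)
    (c : Fin 3 → V) (f : Digraph V → ℕ) (g : List (Fin 3 × Fin 3) × Fin 4 → ℕ)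
    (hfg : ∀ D ∈ A, ∀ q ∈ cornerOrders, HasOrder D c q.1 → f D = g q) :
    ∑ D ∈ A, f D =
      (cornerOrders.map fun q => {D | D ∈ A ∧ HasOrder D c q.1}.ncard * g q).sum := by
  classical
  have hnd : cornerOrders.Nodup := by decide +kernel
  choose! o ho ho' using fun D (hD : D ∈ A) => exists_mem_cornerOrders (hA D hD) c
  rw [← List.sum_toFinset _ hnd, ← Finset.sum_fiberwise_of_maps_to (g := o)
    (fun D hD => List.mem_toFinset.2 (ho D hD))]
  refine Finset.sum_congr rfl fun q hq => ?_
  rw [List.mem_toFinset] at hq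
  have hset : {D | D ∈ A ∧ HasOrder D c q.1} = (A.filter (o · = q) : Finset (Digraph V)) := by
    ext D
    simp only [Set.mem_ofPred_eq, Finset.coe_filter]
    refine and_congr_right fun hD => ⟨fun h => (ho' D hD).unique (ho D hD) hq h, ?_⟩
    rintro rfl
    exact ho' D hD
  rw [hset, Set.ncard_coe_finset, ← smul_eq_mul, ← Finset.sum_const]
  refine Finset.sum_congr rfl fun D hD => ?_
  rw [Finset.mem_filter] at hD
  exact hfg D hD.1 q hq (hD.2 ▸ ho' D hD.1)

end Orientations

/-! ### Extending orientations by gluing one triangle at a time. -/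

section Extensions

variable {V : Type*}

/-- Reachability between the slots from a list. -/
def slotRel (t : ℕ → V) (L : List ℕ) (D : Digraph V) (u v : ℕ) : Prop :=
  u ∈ L ∧ v ∈ L ∧ HasPath D (t u) (t v)

/-- The triangle `s` with the graph `H` on the vertex set `W'` is glued to the graph `G` on the
vertex set `W`, in which the slots from `L` are in use. The acyclic orientations of `H` are
distributed according to `w`. -/
structure IsGluingStep (w : Fin 4 → ℕ) (t : ℕ → V) (L : List ℕ) (G : SimpleGraph V) (W : Set V)
    (s : Gluing) (H : SimpleGraph V) (W' : Set V) : Prop where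
  supp : ∀ u v, G.Adj u v → u ∈ W
  supp' : ∀ u v, H.Adj u v → u ∈ W'
  disjoint : ∀ u v, G.Adj u v → ¬ H.Adj u v
  finite : {D | IsAcyclicOrientation H D}.Finite
  lt : ∀ u ∈ L, u < 10
  corner_lt : ∀ a, s.corner a < 10
  mem : ∀ u ∈ L, t u ∈ W
  corner_mem : ∀ a, t (s.corner a) ∈ W'
  shared : ∀ u ∈ s.shared, u ∈ L ∧ ∃ a, s.corner a = u
  live : ∀ u ∈ s.live, u ∈ L ∨ ∃ a, s.corner a = u
  inter : ∀ x ∈ W, x ∈ W' → ∃ u ∈ s.shared, t u = x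
  ncard : ∀ q ∈ cornerOrders,
    {D | IsAcyclicOrientation H D ∧ HasOrder D (t ∘ s.corner) q.1}.ncard = w q.2

/-- Successive gluing of triangles. -/
def IsGluingChain (w : Fin 4 → ℕ) (t : ℕ → V) :
    List ℕ → SimpleGraph V → Set V → List (Gluing × SimpleGraph V × Set V) → Prop
  | L, _, _, [] => L = [0, 1, 2]
  | L, G, W, (s, H, W') :: l =>
    IsGluingStep w t L G W s H W' ∧ IsGluingChain w t s.live (G ⊔ H) (W ∪ W') l

/-- The acyclic orientations of `G'` that extend the orientation `D₀` of `G` and induce a given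
order of the outer corners. -/
def extensions (t : ℕ → V) (G' G : SimpleGraph V) (D₀ : Digraph V)
    (q : List (Fin 3 × Fin 3)) : Set (Digraph V) :=
  {D | IsAcyclicOrientation G' D ∧ D.restrictTo G = D₀ ∧ HasOrder D (t ∘ Gluing.outer.corner) q}

theorem Gluing.represents_orderCode (s : Gluing) (hs : ∀ a, s.corner a < 10)
    (q : List (Fin 3 × Fin 3)) :
    Represents (s.orderCode q) fun u v => ∃ a b, (a, b) ∈ q ∧ s.corner a = u ∧ s.corner b = v := by
  refine (represents_relCode (q.map fun e => (s.corner e.1, s.corner e.2)) ?_).congr ?_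
  · intro e he
    obtain ⟨a, -, rfl⟩ := List.mem_map.1 he
    exact ⟨hs _, hs _⟩
  · intro u v _ _
    simp

namespace IsGluingStep

variable {w : Fin 4 → ℕ} {t : ℕ → V} (ht : Set.InjOn t {u | u < 10}) {L : List ℕ}
  {G H : SimpleGraph V} {W W' : Set V} {s : Gluing} (h : IsGluingStep w t L G W s H W')

include ht h in
-- Index `false` is the part assembled so far, with the slots in use; `true` is the new triangle,
-- with its corners.
theorem isGluing {D E : Digraph V} (hD : IsOrientation G D) (hE : IsOrientation H E) :
    IsGluing (fun k : Bool => bif k then E.Adj else D.Adj) (fun k => bif k then W' else W) t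
      (fun k => bif k then List.ofFn s.corner else L) s.shared where
  supp k x y hxy := by
    cases k
    · exact ⟨h.supp _ _ (hD.adj hxy), h.supp _ _ (hD.adj hxy).symm⟩
    · exact ⟨h.supp' _ _ (hE.adj hxy), h.supp' _ _ (hE.adj hxy).symm⟩
  inj k l u hu v hv huv := by
    have key : ∀ (k : Bool), ∀ u ∈ (bif k then List.ofFn s.corner else L), u < 10 := by
      intro k u hu
      cases k
      · exact h.lt u hu
      · obtain ⟨a, rfl⟩ := (List.mem_ofFn' _ _).1 hu
        exact h.corner_lt a
    exact ht (key k u hu) (key l v hv) huv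
  mem k u hu := by
    cases k
    · exact h.mem u hu
    · obtain ⟨a, rfl⟩ := (List.mem_ofFn' _ _).1 hu
      exact h.corner_mem a
  sub k u hu := by
    cases k
    · exact (h.shared u hu).1
    · exact (List.mem_ofFn' _ _).2 (h.shared u hu).2
  inter k l hkl x hx hx' := by
    cases k <;> cases l
    · exact absurd rfl hkl
    · exact h.inter x hx hx'
    · exact h.inter x hx' hx
    · exact absurd rfl hkl

theorem sup_adj_eq (D E : Digraph V) :
    (D ⊔ E).Adj = fun x y => ∃ k : Bool, (bif k then E.Adj else D.Adj) x y := by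
  ext x y
  rw [Bool.exists_bool]
  rfl

include h in
-- The union of the old slot relation and the order of the new corners is exactly `partRel`, so the
-- bitwise pivots compute `pivotsRel` of it.
theorem represents_closure {m : ℕ} {D E : Digraph V}
    (hm : Gluing.Represents m (slotRel t L D)) {q : List (Fin 3 × Fin 3)}
    (hq : HasOrder E (t ∘ s.corner) q) :
    Gluing.Represents (s.closure m q) (Gluing.pivotsRel s.shared
      (IsGluing.partRel (fun k : Bool => bif k then E.Adj else D.Adj) t
        (fun k => bif k then List.ofFn s.corner else L))) := by
  refine Gluing.Represents.pivots (fun u hu => h.lt u (h.shared u hu).1) ?_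
  refine (hm.lor (s.represents_orderCode h.corner_lt q)).congr fun u v _ _ => ?_
  rw [IsGluing.partRel, Bool.exists_bool]
  refine or_congr Iff.rfl ⟨?_, ?_⟩
  · rintro ⟨a, b, hab, rfl, rfl⟩
    exact ⟨(List.mem_ofFn' _ _).2 ⟨a, rfl⟩, (List.mem_ofFn' _ _).2 ⟨b, rfl⟩, (hq a b).2 hab⟩
  · rintro ⟨hu, hv, huv⟩
    obtain ⟨a, rfl⟩ := (List.mem_ofFn' _ _).1 hu
    obtain ⟨b, rfl⟩ := (List.mem_ofFn' _ _).1 hv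
    exact ⟨a, b, (hq a b).1 huv, rfl, rfl⟩

include ht h in
theorem acyclic_iff {m : ℕ} {D E : Digraph V} (hD : IsAcyclicOrientation G D)
    (hE : IsAcyclicOrientation H E) (hm : Gluing.Represents m (slotRel t L D))
    {q : List (Fin 3 × Fin 3)} (hq : HasOrder E (t ∘ s.corner) q) :
    (∀ v, ¬ HasPath (D ⊔ E) v v) ↔
      Nat.beq (Nat.land (s.closure m q) Gluing.diagMask) 0 = true := by
  have hg := h.isGluing ht hD.1 hE.1
  rw [(h.represents_closure hm hq).land_diagMask]
  simp only [HasPath, sup_adj_eq, hg.acyclic_iff]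
  constructor
  · exact fun h u _ => h.2 u
  · refine fun h' => ⟨?_, fun u hu => ?_⟩
    · rintro (_ | _)
      · exact hD.2
      · exact hE.2
    · by_cases hu10 : u < 10
      · exact h' u hu10 hu
      -- The code only sees slots below ten. A cycle at `u` begins with a step from `u`, so `u` is a
      -- slot in use or a corner, and these are all below ten.
      · obtain ⟨v, ⟨k, huk, -⟩, -⟩ := (TransGen.head'_iff).1 (Gluing.transGen_of_pivotsRel _ hu)
        cases k
        · exact hu10 (h.lt u huk)
        · obtain ⟨a, rfl⟩ := (List.mem_ofFn' _ _).1 huk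
          exact hu10 (h.corner_lt a)

include ht h in
theorem represents_sup {m : ℕ} {D E : Digraph V} (hD : IsAcyclicOrientation G D)
    (hE : IsAcyclicOrientation H E) (hm : Gluing.Represents m (slotRel t L D))
    {q : List (Fin 3 × Fin 3)} (hq : HasOrder E (t ∘ s.corner) q) :
    Gluing.Represents (Nat.land (s.closure m q) (Gluing.pairMask s.live))
      (slotRel t s.live (D ⊔ E)) := by
  have hg := h.isGluing ht hD.1 hE.1
  have hlive : ∀ u ∈ s.live, ∃ k : Bool, u ∈ (bif k then List.ofFn s.corner else L) := by
    intro u hu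
    rcases h.live u hu with hu | hu
    · exact ⟨false, hu⟩
    · exact ⟨true, (List.mem_ofFn' _ _).2 hu⟩
  refine ((h.represents_closure hm hq).land_pairMask fun u hu => ?_).congr fun u v _ _ => ?_
  · rcases h.live u hu with hu | ⟨a, rfl⟩
    · exact h.lt u hu
    · exact h.corner_lt a
  · rw [slotRel, and_rotate, HasPath, sup_adj_eq]
    refine ⟨fun ⟨hu, hv, huv⟩ => ⟨hu, hv, ?_⟩, fun ⟨hu, hv, huv⟩ => ⟨hu, hv, ?_⟩⟩
    all_goals
      obtain ⟨k, hk⟩ := hlive u hu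
      obtain ⟨l, hl⟩ := hlive v hv
    · exact (hg.transGen_iff hk hl).2 huv
    · exact (hg.transGen_iff hk hl).1 huv

include h in
-- The extensions are sorted by their restriction to the new triangle, which is again an acyclic
-- orientation.
theorem ncard_extensions (G' : SimpleGraph V) (hG' : H ≤ G') {D₀ : Digraph V}
    (hG'fin : {D | IsAcyclicOrientation G' D}.Finite)
    (hD₀ : IsAcyclicOrientation G D₀) (q : List (Fin 3 × Fin 3)) :
    (extensions t G' G D₀ q).ncard =
      ∑ E ∈ h.finite.toFinset, (extensions t G' (G ⊔ H) (D₀ ⊔ E) q).ncard := by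
  classical
  have hfin : ∀ G D₀, (extensions t G' G D₀ q).Finite := fun G D₀ =>
    hG'fin.subset fun D hD => hD.1
  rw [Set.ncard_eq_toFinset_card _ (hfin G D₀),
    Finset.card_eq_sum_card_fiberwise (f := fun D => D.restrictTo H) (t := h.finite.toFinset)]
  · refine Finset.sum_congr rfl fun E hE => ?_
    rw [Set.Finite.mem_toFinset] at hE
    rw [Set.ncard_eq_toFinset_card _ (hfin _ _)]
    congr 1
    ext D
    simp only [Finset.mem_filter, Set.Finite.mem_toFinset, extensions, Set.mem_ofPred_eq,
      restrictTo_sup_eq_iff hD₀.1 hE.1 h.disjoint]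
    tauto
  · intro D hD
    simp only [Finset.mem_coe, Set.Finite.mem_toFinset] at hD ⊢
    exact hD.1.restrictTo hG'

end IsGluingStep

/-- The union of the graphs glued in a chain. -/
def gluedGraph (G : SimpleGraph V) : List (Gluing × SimpleGraph V × Set V) → SimpleGraph V
  | [] => G
  | (_, H, _) :: l => gluedGraph (G ⊔ H) l

theorem le_gluedGraph (G : SimpleGraph V) (l : List (Gluing × SimpleGraph V × Set V)) :
    G ≤ gluedGraph G l := by
  induction l generalizing G with
  | nil => exact le_rfl
  | cons x l ih => exact le_sup_left.trans (ih _)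

theorem hasOrder_outer_iff {t : ℕ → V} {D : Digraph V} {m : ℕ}
    (hm : Gluing.Represents m (slotRel t [0, 1, 2] D)) (q : List (Fin 3 × Fin 3)) :
    HasOrder D (t ∘ Gluing.outer.corner) q ↔ m = Gluing.outer.orderCode q := by
  have hlt : ∀ a, Gluing.outer.corner a < 10 := by decide
  have hinj : ∀ a b, Gluing.outer.corner a = Gluing.outer.corner b → a = b := by decide
  have hmem : ∀ a, Gluing.outer.corner a ∈ [0, 1, 2] := by decide
  have hsurj : ∀ u ∈ [0, 1, 2], ∃ a, Gluing.outer.corner a = u := by decide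
  rw [hm.eq_iff (Gluing.represents_orderCode _ hlt q)]
  constructor
  · intro h u v _ _
    constructor
    · rintro ⟨hu, hv, huv⟩
      obtain ⟨a, rfl⟩ := hsurj u hu
      obtain ⟨b, rfl⟩ := hsurj v hv
      exact ⟨a, b, (h a b).1 huv, rfl, rfl⟩
    · rintro ⟨a, b, hab, rfl, rfl⟩
      exact ⟨hmem a, hmem b, (h a b).2 hab⟩
  · intro h a b
    have hab := h _ _ (hlt a) (hlt b)
    constructor
    · intro hp
      obtain ⟨a', b', hq, ha, hb⟩ := hab.1 ⟨hmem a, hmem b, hp⟩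
      rwa [hinj _ _ ha, hinj _ _ hb] at hq
    · exact fun hq => (hab.2 ⟨a, b, hq, rfl, rfl⟩).2.2

/-- The number of acyclic orientations of a glued graph that extend a given one. -/
theorem IsGluingChain.ncard_extensions {w : Fin 4 → ℕ} {t : ℕ → V}
    (ht : Set.InjOn t {u | u < 10}) (q : List (Fin 3 × Fin 3))
    (l : List (Gluing × SimpleGraph V × Set V)) {L : List ℕ} {G : SimpleGraph V} {W : Set V}
    (h : IsGluingChain w t L G W l)
    (hfin : {D | IsAcyclicOrientation (gluedGraph G l) D}.Finite) {D₀ : Digraph V}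
    (hD₀ : IsAcyclicOrientation G D₀) {m : ℕ} (hm : Gluing.Represents m (slotRel t L D₀)) :
    (extensions t (gluedGraph G l) G D₀ q).ncard =
      Gluing.extCount w (Gluing.outer.orderCode q) (l.map Prod.fst) m := by
  induction l generalizing L G W D₀ m with
  | nil =>
    obtain rfl : L = [0, 1, 2] := h
    have hset : extensions t (gluedGraph G []) G D₀ q =
        {D | D = D₀ ∧ m = Gluing.outer.orderCode q} := by
      ext D
      constructor
      · rintro ⟨h1, h2, h3⟩
        have h2 : D.restrictTo G = D₀ := h2
        rw [IsOrientation.restrictTo_self (G := G) h1.1] at h2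
        subst h2
        exact ⟨rfl, (hasOrder_outer_iff hm q).1 h3⟩
      · rintro ⟨rfl, h3⟩
        exact ⟨hD₀, hD₀.1.restrictTo_self, (hasOrder_outer_iff hm q).2 h3⟩
    rw [hset, List.map_nil, Gluing.extCount]
    by_cases hmq : m = Gluing.outer.orderCode q
    · simp [hmq]
    · have hb : Nat.beq m (Gluing.outer.orderCode q) = false :=
        Bool.eq_false_iff.2 fun hb => hmq (Nat.eq_of_beq_eq_true hb)
      rw [hb]
      simp [hmq]
  | cons x l ih =>
    obtain ⟨s, H, W'⟩ := x
    obtain ⟨hs, hl⟩ := h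
    rw [hs.ncard_extensions (gluedGraph G ((s, H, W') :: l))
      (le_sup_right.trans (le_gluedGraph (G ⊔ H) l)) hfin hD₀ q,
      sum_eq_sum_cornerOrders _ (fun E hE => ((Set.Finite.mem_toFinset _).1 hE).2)
        (t ∘ s.corner) _ (fun p => bif Nat.beq (Nat.land (s.closure m p.1) Gluing.diagMask) 0 then
          Gluing.extCount w (Gluing.outer.orderCode q) (l.map Prod.fst)
            (Nat.land (s.closure m p.1) (Gluing.pairMask s.live)) else 0),
      List.map_cons, Gluing.extCount]
    · refine congrArg List.sum (List.map_congr_left fun p hp => ?_)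
      rw [← hs.ncard p hp]
      simp only [Set.Finite.mem_toFinset]
      rfl
    · intro E hE p _ hEp
      rw [Set.Finite.mem_toFinset] at hE
      rcases hb : Nat.beq (Nat.land (s.closure m p.1) Gluing.diagMask) 0 with _ | _
      -- A bit on the diagonal is a cycle in `D₀ ⊔ E`, and it would survive in any extension.
      · rw [cond_false, ← Set.ncard_empty (Digraph V)]
        refine congrArg Set.ncard (Set.eq_empty_iff_forall_notMem.2 ?_)
        rintro D ⟨h1, h2, -⟩
        refine Bool.false_ne_true (hb.symm.trans ((hs.acyclic_iff ht hD₀ hE hm hEp).1 ?_))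
        rw [← h2]
        exact (h1.restrictTo (le_gluedGraph (G ⊔ H) l)).2
      · exact ih hl hfin ⟨hD₀.1.sup hE.1 hs.disjoint, (hs.acyclic_iff ht hD₀ hE hm hEp).2 hb⟩
          (hs.represents_sup ht hD₀ hE hm hEp)

/-- The distribution of the acyclic orientations of a graph glued from six triangles. -/
theorem IsGluingChain.ncard_sixCopies {w : Fin 4 → ℕ} {t : ℕ → V}
    (ht : Set.InjOn t {u | u < 10}) {q : List (Fin 3 × Fin 3) × Fin 4} (hq : q ∈ cornerOrders)
    {l : List (Gluing × SimpleGraph V × Set V)} (h : IsGluingChain w t [] ⊥ ∅ l)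
    (hl : l.map Prod.fst = Gluing.sixCopies)
    (hfin : {D | IsAcyclicOrientation (gluedGraph ⊥ l) D}.Finite) :
    {D | IsAcyclicOrientation (gluedGraph ⊥ l) D ∧
      HasOrder D (t ∘ Gluing.outer.corner) q.1}.ncard = recPoly w q.2 := by
  have hbot : ∀ u v, ¬ HasPath (⊥ : Digraph V) u v := by
    intro u v huv
    obtain ⟨_, h, _⟩ := TransGen.head'_iff.1 huv
    exact h
  -- The gluing starts from the empty graph with no slots in use: the code 0 represents its only
  -- orientation, which every orientation extends.
  rw [← extCount_sixCopies w hq, ← hl, ← h.ncard_extensions ht q.1 l hfin (D₀ := ⊥) (m := 0)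
    ⟨⟨fun u v => by simp, fun u v h => h.elim⟩, fun v => hbot v v⟩
    (Gluing.represents_zero.congr fun u v _ _ => by simp [slotRel])]
  congr 1
  ext D
  refine and_congr_right fun _ => (and_iff_right ?_).symm
  ext u v
  simp [Digraph.restrictTo]

end Extensions

/-! ### Acyclic orientations under embeddings -/

section Map

variable {V W : Type*}

/-- The image of a digraph under a map. -/
def Digraph.mapAlong (f : V → W) (D : Digraph V) : Digraph W := ⟨Relation.Map D.Adj f f⟩

theorem Digraph.mapAlong_adj {f : V ↪ W} {D : Digraph V} {u v : V} :
    (D.mapAlong f).Adj (f u) (f v) ↔ D.Adj u v := by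
  constructor
  · rintro ⟨u', v', h, hu, hv⟩
    rwa [f.injective hu, f.injective hv] at h
  · exact fun h => ⟨u, v, h, rfl, rfl⟩

theorem exists_of_hasPath_mapAlong {f : V ↪ W} {D : Digraph V} {x y : W}
    (h : HasPath (D.mapAlong f) x y) : ∃ u v, f u = x ∧ f v = y ∧ HasPath D u v := by
  induction h with
  | single h =>
    obtain ⟨u, v, h, hu, hv⟩ := h
    exact ⟨u, v, hu, hv, .single h⟩
  | tail _ h ih =>
    obtain ⟨u, v, hu, hv, ih⟩ := ih
    obtain ⟨v', z, h, hv', hz⟩ := h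
    obtain rfl := f.injective (hv.trans hv'.symm)
    exact ⟨u, z, hu, hz, ih.tail h⟩

theorem hasPath_mapAlong {f : V ↪ W} {D : Digraph V} {u v : V} :
    HasPath (D.mapAlong f) (f u) (f v) ↔ HasPath D u v := by
  constructor
  · intro h
    obtain ⟨u', v', hu, hv, h⟩ := exists_of_hasPath_mapAlong h
    rwa [f.injective hu, f.injective hv] at h
  · exact TransGen.lift f (fun a b h => ⟨a, b, h, rfl, rfl⟩) u v

theorem isAcyclicOrientation_mapAlong {f : V ↪ W} {G : SimpleGraph V} {D : Digraph V} :
    IsAcyclicOrientation (G.map f) (D.mapAlong f) ↔ IsAcyclicOrientation G D := by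
  constructor
  · rintro ⟨⟨h1, h2⟩, h3⟩
    refine ⟨⟨fun u v => ?_, fun u v huv hvu => ?_⟩, fun v hv => h3 (f v) (hasPath_mapAlong.2 hv)⟩
    · rw [← SimpleGraph.map_adj_apply (f := f), h1, Digraph.mapAlong_adj, Digraph.mapAlong_adj]
    · exact h2 (f u) (f v) (Digraph.mapAlong_adj.2 huv) (Digraph.mapAlong_adj.2 hvu)
  · rintro ⟨⟨h1, h2⟩, h3⟩
    refine ⟨⟨fun x y => ?_, ?_⟩, fun x hx => ?_⟩
    · rw [SimpleGraph.map_adj]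
      constructor
      · rintro ⟨u, v, h, rfl, rfl⟩
        rwa [Digraph.mapAlong_adj, Digraph.mapAlong_adj, ← h1]
      · rintro (⟨u, v, h, rfl, rfl⟩ | ⟨u, v, h, rfl, rfl⟩)
        · exact ⟨u, v, (h1 u v).2 (Or.inl h), rfl, rfl⟩
        · exact ⟨v, u, (h1 v u).2 (Or.inr h), rfl, rfl⟩
    · rintro x y ⟨u, v, h, rfl, rfl⟩ h'
      exact h2 u v h (Digraph.mapAlong_adj.1 h')
    · obtain ⟨u, v, rfl, hv, h⟩ := exists_of_hasPath_mapAlong hx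
      obtain rfl := f.injective hv
      exact h3 v h

/-- The distribution of acyclic orientations is invariant under embeddings. -/
theorem ncard_hasOrder_map (f : V ↪ W) (G : SimpleGraph V) (c : Fin 3 → V)
    (q : List (Fin 3 × Fin 3)) :
    {D | IsAcyclicOrientation (G.map f) D ∧ HasOrder D (f ∘ c) q}.ncard =
      {D | IsAcyclicOrientation G D ∧ HasOrder D c q}.ncard := by
  have hinj : Function.Injective (Digraph.mapAlong f) := by
    intro D E h
    ext u v
    rw [← Digraph.mapAlong_adj (f := f), h, Digraph.mapAlong_adj]
  rw [← Set.ncard_image_of_injective _ hinj]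
  congr 1
  ext E
  constructor
  · rintro ⟨hE, hq⟩
    have hEf : Digraph.mapAlong f ⟨fun u v => E.Adj (f u) (f v)⟩ = E := by
      ext x y
      constructor
      · rintro ⟨u, v, h, rfl, rfl⟩
        exact h
      · intro h
        obtain ⟨u, v, -, rfl, rfl⟩ := (SimpleGraph.map_adj ..).1 (hE.1.adj h)
        exact ⟨u, v, h, rfl, rfl⟩
    refine ⟨_, ⟨isAcyclicOrientation_mapAlong.1 (hEf.symm ▸ hE), fun a b => ?_⟩, hEf⟩
    rw [← hq a b, ← hasPath_mapAlong (f := f), hEf]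
    rfl
  · rintro ⟨D, ⟨hD, hq⟩, rfl⟩
    exact ⟨isAcyclicOrientation_mapAlong.2 hD, fun a b => hasPath_mapAlong.trans (hq a b)⟩

end Map

/-! ### The stages of the gasket -/

theorem mem_sgVertices_of_adj (b n : ℕ) :
    ∀ u v, (sgEdges b n).Adj u v → u ∈ sgVertices b n ∧ v ∈ sgVertices b n := by
  induction n with
  | zero =>
    intro u v h
    rw [sgEdges, SimpleGraph.fromEdgeSet_adj] at h
    simp only [Set.mem_insert_iff, Set.mem_singleton_iff, Sym2.eq_iff] at h
    rcases h.1 with (⟨rfl, rfl⟩ | ⟨rfl, rfl⟩) | (⟨rfl, rfl⟩ | ⟨rfl, rfl⟩) |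
      (⟨rfl, rfl⟩ | ⟨rfl, rfl⟩) <;> simp [sgVertices]
  | succ n ih =>
    intro u v h
    simp only [sgEdges, SimpleGraph.iSup_adj, SimpleGraph.map_adj] at h
    obtain ⟨s, hs, u, v, h, rfl, rfl⟩ := h
    simp only [sgVertices, Finset.mem_biUnion, Finset.mem_image]
    exact ⟨⟨s, hs, u, (ih u v h).1, rfl⟩, ⟨s, hs, v, (ih u v h).2, rfl⟩⟩

/-- Counting can move from the vertex subtype to the whole lattice, where all stages and all copies
live on the same vertex type. -/
theorem map_SG (b n : ℕ) : (SG b n).map (Function.Embedding.subtype _) = sgEdges b n := by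
  ext u v
  rw [SimpleGraph.map_adj]
  constructor
  · rintro ⟨u, v, h, rfl, rfl⟩
    exact h
  · intro h
    obtain ⟨hu, hv⟩ := mem_sgVertices_of_adj b n u v h
    exact ⟨⟨u, hu⟩, ⟨v, hv⟩, h, rfl, rfl⟩

theorem finite_setOf_sgEdges_adj (b n : ℕ) :
    {e : (ℕ × ℕ) × (ℕ × ℕ) | (sgEdges b n).Adj e.1 e.2}.Finite :=
  ((sgVertices b n) ×ˢ (sgVertices b n)).finite_toSet.subset fun _ he =>
    Finset.mem_coe.2 (Finset.mem_product.2 (mem_sgVertices_of_adj b n _ _ he))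

theorem sum_le_of_mem_sgVertices (n : ℕ) : ∀ v ∈ sgVertices 3 n, v.1 + v.2 ≤ 3 ^ n := by
  induction n with
  | zero => decide
  | succ n ih =>
    intro v hv
    simp only [sgVertices, Finset.mem_biUnion, Finset.mem_image] at hv
    obtain ⟨s, hs, v, hv, rfl⟩ := hv
    have hs' : s.1 + s.2 ≤ 2 := by
      rw [sgCopies, Finset.mem_filter] at hs
      omega
    have := ih v hv
    simp only [Prod.fst_add, Prod.snd_add, Prod.smul_fst, Prod.smul_snd, smul_eq_mul]
    rw [pow_succ]
    nlinarith [Nat.mul_le_mul_left (3 ^ n) hs']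

/-- The distribution of the acyclic orientations of stage `n` according to the order of the
corners is given by `w`. -/
def IsDistribution (n : ℕ) (w : Fin 4 → ℕ) : Prop :=
  ∀ q ∈ cornerOrders, {D | IsAcyclicOrientation (SG 3 n) D ∧
    HasOrder D ![sgRight 3 n, sgTop 3 n, sgLeft 3 n] q.1}.ncard = w q.2

/-- The unit vectors pointing from the left corner of a triangle to its corners. -/
def cornerDir : Fin 3 → ℕ × ℕ := ![(1, 0), (0, 1), (0, 0)]

theorem isDistribution_iff (n : ℕ) (w : Fin 4 → ℕ) :
    IsDistribution n w ↔ ∀ q ∈ cornerOrders, {D | IsAcyclicOrientation (sgEdges 3 n) D ∧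
      HasOrder D (fun a => 3 ^ n • cornerDir a) q.1}.ncard = w q.2 := by
  refine forall₂_congr fun q _ => ?_
  rw [← ncard_hasOrder_map (Function.Embedding.subtype _), map_SG]
  have h : (Function.Embedding.subtype _ ∘ ![sgRight 3 n, sgTop 3 n, sgLeft 3 n] : Fin 3 → ℕ × ℕ)
      = fun a => 3 ^ n • cornerDir a := by
    funext a
    fin_cases a <;> simp [cornerDir, sgRight, sgTop, sgLeft]
  rw [h]

/-- The unit triangle. -/
def cornerEmbedding : Fin 3 ↪ ℕ × ℕ := ⟨cornerDir, by decide⟩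

/-- An acyclic orientation of a triangle is a linear order of its corners, so each chain arises once
and nothing else occurs. -/
theorem isDistribution_zero : IsDistribution 0 ![1, 0, 0, 0] := by
  rw [isDistribution_iff]
  intro q hq
  have hG : sgEdges 3 0 = (⊤ : SimpleGraph (Fin 3)).map cornerEmbedding := by
    ext u v
    rw [sgEdges, SimpleGraph.fromEdgeSet_adj, SimpleGraph.map_adj]
    simp only [Set.mem_insert_iff, Set.mem_singleton_iff, Sym2.eq_iff, SimpleGraph.top_adj]
    constructor
    · rintro ⟨(⟨rfl, rfl⟩ | ⟨rfl, rfl⟩) | (⟨rfl, rfl⟩ | ⟨rfl, rfl⟩) |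
        (⟨rfl, rfl⟩ | ⟨rfl, rfl⟩), -⟩
      · exact ⟨2, 0, by decide, rfl, rfl⟩
      · exact ⟨0, 2, by decide, rfl, rfl⟩
      · exact ⟨0, 1, by decide, rfl, rfl⟩
      · exact ⟨1, 0, by decide, rfl, rfl⟩
      · exact ⟨1, 2, by decide, rfl, rfl⟩
      · exact ⟨2, 1, by decide, rfl, rfl⟩
    · rintro ⟨a, b, hab, rfl, rfl⟩
      revert a b
      decide
  have hc : (fun a => 3 ^ 0 • cornerDir a) =
      cornerEmbedding ∘ (id : Fin 3 → Fin 3) := by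
    funext a
    exact one_smul ℕ _
  rw [hG, hc, ncard_hasOrder_map]
  -- In a complete graph a path from `a` to `b` forces the arc to point the same way, since the
  -- opposite arc would close a cycle.
  have key : ∀ D : Digraph (Fin 3), IsAcyclicOrientation ⊤ D → HasOrder D id q.1 →
      ∀ a b, D.Adj a b ↔ (a, b) ∈ q.1 := by
    intro D hD hDq a b
    rw [← hDq a b]
    refine ⟨fun h => .single h, fun h => ?_⟩
    have hne : a ≠ b := by
      rintro rfl
      exact hD.2 a h
    exact ((hD.1.1 a b).1 hne).resolve_right fun h' => hD.2 a (h.tail h')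
  by_cases h0 : q.2 = 0
  · have h1 : ∀ q ∈ cornerOrders, q.2 = 0 →
        ∀ a b, a ≠ b ↔ (a, b) ∈ q.1 ∨ (b, a) ∈ q.1 := by decide +kernel
    have h2 : ∀ q ∈ cornerOrders, ∀ a b, (a, b) ∈ q.1 → (b, a) ∉ q.1 := by decide +kernel
    have h3 : ∀ q ∈ cornerOrders, ∀ a b c, (a, b) ∈ q.1 → (b, c) ∈ q.1 → (a, c) ∈ q.1 := by
      decide +kernel
    replace h1 := h1 q hq h0
    replace h2 := h2 q hq
    replace h3 := h3 q hq
    have hpath : ∀ a b, HasPath (⟨fun a b => (a, b) ∈ q.1⟩ : Digraph (Fin 3)) a b ↔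
        (a, b) ∈ q.1 := by
      refine fun a b => ⟨fun h => ?_, fun h => .single h⟩
      induction h with
      | single h => exact h
      | tail _ h ih => exact h3 _ _ _ ih h
    rw [h0, Set.ncard_eq_one.2 ⟨⟨fun a b => (a, b) ∈ q.1⟩, ?_⟩]
    · rfl
    · ext D
      constructor
      · rintro ⟨hD, hDq⟩
        rw [Set.mem_singleton_iff]
        ext a b
        exact key D hD hDq a b
      · rintro rfl
        refine ⟨⟨⟨h1, h2⟩, fun a ha => ?_⟩, hpath⟩
        exact h2 a a ((hpath a a).1 ha) ((hpath a a).1 ha)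
  · have hinc : ∀ q ∈ cornerOrders, q.2 ≠ 0 →
        (![1, 0, 0, 0] : Fin 4 → ℕ) q.2 = 0 ∧ ∃ a b, a ≠ b ∧ (a, b) ∉ q.1 ∧ (b, a) ∉ q.1 := by
      decide +kernel
    obtain ⟨h1, a, b, hab, h2, h3⟩ := hinc q hq h0
    rw [h1, ← Set.ncard_empty (Digraph (Fin 3))]
    refine congrArg Set.ncard (Set.eq_empty_iff_forall_notMem.2 ?_)
    rintro D ⟨hD, hDq⟩
    rcases (hD.1.1 a b).1 hab with h | h
    · exact h2 ((key D hD hDq a b).1 h)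
    · exact h3 ((key D hD hDq b a).1 h)

/-! ### The six copies and their incidences in the lattice. -/

/-- The places of the slots, in units of the side length of the copies. -/
def slotPlace (u : ℕ) : ℕ × ℕ :=
  -- The default value serves slots from ten on, which never occur.
  [(0, 0), (3, 0), (0, 3), (1, 0), (2, 0), (0, 1), (1, 1), (2, 1), (0, 2), (1, 2)].getD u (0, 0)

/-- The triangle at a given place in which a copy of stage `n` lies. -/
def copyRegion (n : ℕ) (p : ℕ × ℕ) : Set (ℕ × ℕ) :=
  {x | 3 ^ n * p.1 ≤ x.1 ∧ 3 ^ n * p.2 ≤ x.2 ∧ x.1 + x.2 ≤ 3 ^ n * (p.1 + p.2 + 1)}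

/-- The copy of stage `n` at a given place. -/
def copyGraph (n : ℕ) (p : ℕ × ℕ) : SimpleGraph (ℕ × ℕ) :=
  (sgEdges 3 n).map (addLeftEmbedding (3 ^ n • p))

theorem mem_copyRegion_of_adj {n : ℕ} {p u v : ℕ × ℕ} (h : (copyGraph n p).Adj u v) :
    u ∈ copyRegion n p := by
  rw [copyGraph, SimpleGraph.map_adj] at h
  obtain ⟨u, v, h, rfl, rfl⟩ := h
  have hu := sum_le_of_mem_sgVertices n u (mem_sgVertices_of_adj 3 n u v h).1
  simp only [copyRegion, addLeftEmbedding_apply, Set.mem_ofPred_eq, Prod.fst_add, Prod.snd_add,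
    Prod.smul_fst, Prod.smul_snd, smul_eq_mul]
  refine ⟨by omega, by omega, ?_⟩
  rw [mul_add, mul_add]
  omega

theorem smul_add_cornerDir_mem (n : ℕ) (p : ℕ × ℕ) (a : Fin 3) :
    3 ^ n • (p + cornerDir a) ∈ copyRegion n p := by
  simp only [copyRegion, Set.mem_ofPred_eq, Prod.fst_add, Prod.snd_add, Prod.smul_fst,
    Prod.smul_snd, smul_eq_mul, mul_add]
  fin_cases a <;> simp [cornerDir] <;> omega

/-- The triangles at two places meet in at most one point. -/
theorem eq_of_mem_copyRegion {n : ℕ} {p p' x : ℕ × ℕ} (hp : p ≠ p') (hx : x ∈ copyRegion n p)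
    (hx' : x ∈ copyRegion n p') :
    x = 3 ^ n • (p ⊔ p') ∧ (p ⊔ p').1 + (p ⊔ p').2 ≤ min (p.1 + p.2) (p'.1 + p'.2) + 1 := by
  obtain ⟨h1, h2, h3⟩ := hx
  obtain ⟨h1', h2', h3'⟩ := hx'
  have hN : 0 < 3 ^ n := by positivity
  have e1 : 3 ^ n * max p.1 p'.1 ≤ x.1 := by
    rcases max_choice p.1 p'.1 with h | h <;> rwa [h]
  have e2 : 3 ^ n * max p.2 p'.2 ≤ x.2 := by
    rcases max_choice p.2 p'.2 with h | h <;> rwa [h]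
  have e3 : x.1 + x.2 ≤ 3 ^ n * (min (p.1 + p.2) (p'.1 + p'.2) + 1) := by
    rcases min_choice (p.1 + p.2) (p'.1 + p'.2) with h | h <;> rwa [h]
  -- Otherwise the join `p ⊔ p'` has coordinate sum at most those of `p` and `p'`, so both are equal
  -- to it.
  have hne : min (p.1 + p.2) (p'.1 + p'.2) + 1 ≤ max p.1 p'.1 + max p.2 p'.2 := by
    by_contra h
    refine hp (Prod.ext ?_ ?_) <;> omega
  have hle : max p.1 p'.1 + max p.2 p'.2 ≤ min (p.1 + p.2) (p'.1 + p'.2) + 1 := by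
    refine Nat.le_of_mul_le_mul_left ?_ hN
    rw [mul_add]
    omega
  refine ⟨?_, hle⟩
  rw [← le_antisymm hle hne, mul_add] at e3
  refine Prod.ext ?_ ?_
  · change x.1 = 3 ^ n * max p.1 p'.1
    omega
  · change x.2 = 3 ^ n * max p.2 p'.2
    omega

/-- The incidences that make a triangle glued at place `p` fit to the slots `L` in use and the
triangles at the places `ps`. -/
def StepFits (ps : List (ℕ × ℕ)) (L : List ℕ) (s : Gluing) (p : ℕ × ℕ) : Prop :=
  (∀ u ∈ L, u < 10 ∧ ∃ p' ∈ ps, ∃ a, slotPlace u = p' + cornerDir a) ∧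
  (∀ a, s.corner a < 10 ∧ slotPlace (s.corner a) = p + cornerDir a) ∧
  (∀ u ∈ s.shared, u ∈ L ∧ ∃ a, s.corner a = u) ∧
  (∀ u ∈ s.live, u ∈ L ∨ ∃ a, s.corner a = u) ∧
  ∀ p' ∈ ps, p' ≠ p ∧ ((p' ⊔ p).1 + (p' ⊔ p).2 ≤ min (p'.1 + p'.2) (p.1 + p.2) + 1 →
    ∃ u ∈ s.shared, slotPlace u = p' ⊔ p)

instance (ps : List (ℕ × ℕ)) (L : List ℕ) (s : Gluing) (p : ℕ × ℕ) :
    Decidable (StepFits ps L s p) := by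
  unfold StepFits
  infer_instance

/-- Independent of `n`, the fit is a finite check on places. The geometry enters through
`eq_of_mem_copyRegion`, and the distribution of the copy through invariance under translation. -/
theorem StepFits.isGluingStep {n : ℕ} {w : Fin 4 → ℕ} (hw : IsDistribution n w)
    {ps : List (ℕ × ℕ)} {L : List ℕ} {s : Gluing} {p : ℕ × ℕ} (h : StepFits ps L s p)
    {G : SimpleGraph (ℕ × ℕ)}
    (hG : ∀ u v, G.Adj u v → ∃ p' ∈ ps, (copyGraph n p').Adj u v) :
    IsGluingStep w (fun u => 3 ^ n • slotPlace u) L G {x | ∃ p' ∈ ps, x ∈ copyRegion n p'} s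
      (copyGraph n p) (copyRegion n p) := by
  obtain ⟨h1, h2, h3, h4, h5⟩ := h
  refine ⟨?_, fun u v => mem_copyRegion_of_adj, ?_, ?_, fun u hu => (h1 u hu).1,
    fun a => (h2 a).1, ?_, ?_, h3, h4, ?_, ?_⟩
  · intro u v huv
    obtain ⟨p', hp', h⟩ := hG u v huv
    exact ⟨p', hp', mem_copyRegion_of_adj h⟩
  · intro u v huv huv'
    obtain ⟨p', hp', h⟩ := hG u v huv
    -- Both ends of a common edge would be the single common point of the two regions.
    refine huv.ne ?_
    rw [(eq_of_mem_copyRegion (h5 p' hp').1 (mem_copyRegion_of_adj h)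
      (mem_copyRegion_of_adj huv')).1, (eq_of_mem_copyRegion (h5 p' hp').1
      (mem_copyRegion_of_adj h.symm) (mem_copyRegion_of_adj huv'.symm)).1]
  · refine finite_setOf_isAcyclicOrientation (((finite_setOf_sgEdges_adj 3 n).image
      (Prod.map (addLeftEmbedding (3 ^ n • p)) (addLeftEmbedding (3 ^ n • p)))).subset ?_)
    rintro ⟨x, y⟩ hxy
    obtain ⟨u, v, h, rfl, rfl⟩ := (SimpleGraph.map_adj ..).1 hxy
    exact ⟨(u, v), h, rfl⟩
  · intro u hu
    obtain ⟨-, p', hp', a, ha⟩ := h1 u hu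
    refine ⟨p', hp', ?_⟩
    rw [ha]
    exact smul_add_cornerDir_mem n p' a
  · intro a
    rw [(h2 a).2]
    exact smul_add_cornerDir_mem n p a
  · rintro x ⟨p', hp', hx⟩ hx'
    obtain ⟨hx1, hx2⟩ := eq_of_mem_copyRegion (h5 p' hp').1 hx hx'
    obtain ⟨u, hu, hup⟩ := (h5 p' hp').2 hx2
    exact ⟨u, hu, by rw [hup, hx1]⟩
  · intro q hq
    rw [← (isDistribution_iff n w).1 hw q hq,
      ← ncard_hasOrder_map (addLeftEmbedding (3 ^ n • p)) (sgEdges 3 n)]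
    have hc : (fun u => 3 ^ n • slotPlace u) ∘ s.corner =
        addLeftEmbedding (3 ^ n • p) ∘ fun a => 3 ^ n • cornerDir a := by
      funext a
      simp only [Function.comp_apply, (h2 a).2, smul_add, addLeftEmbedding_apply]
    rw [hc]
    rfl

/-- The incidences for successive gluing. -/
def ChainFits : List (ℕ × ℕ) → List ℕ → List (Gluing × (ℕ × ℕ)) → Bool
  | _, L, [] => decide (L = [0, 1, 2])
  | ps, L, (s, p) :: l => decide (StepFits ps L s p) && ChainFits (p :: ps) s.live l

theorem isGluingChain_of_chainFits {n : ℕ} {w : Fin 4 → ℕ} (hw : IsDistribution n w)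
    (l : List (Gluing × (ℕ × ℕ))) {ps : List (ℕ × ℕ)} {L : List ℕ}
    (h : ChainFits ps L l = true) {G : SimpleGraph (ℕ × ℕ)} {W : Set (ℕ × ℕ)}
    (hG : ∀ u v, G.Adj u v → ∃ p' ∈ ps, (copyGraph n p').Adj u v)
    (hW : W = {x | ∃ p' ∈ ps, x ∈ copyRegion n p'}) :
    IsGluingChain w (fun u => 3 ^ n • slotPlace u) L G W
      (l.map fun x => (x.1, copyGraph n x.2, copyRegion n x.2)) := by
  induction l generalizing ps L G W with
  | nil => exact (of_decide_eq_true h : L = [0, 1, 2])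
  | cons x l ih =>
    obtain ⟨s, p⟩ := x
    rw [ChainFits, Bool.and_eq_true, decide_eq_true_eq] at h
    subst hW
    refine ⟨h.1.isGluingStep hw hG, ih h.2 ?_ ?_⟩
    · rintro u v (huv | huv)
      · obtain ⟨p', hp', h⟩ := hG u v huv
        exact ⟨p', List.mem_cons_of_mem _ hp', h⟩
      · exact ⟨p, List.mem_cons_self, huv⟩
    · ext x
      simp [or_comm]

/-- The places of the six copies. -/
def copyPlaces : List (ℕ × ℕ) := [(0, 0), (1, 0), (2, 0), (1, 1), (0, 1), (0, 2)]

theorem gluedGraph_adj {V : Type*} {G : SimpleGraph V}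
    {l : List (Gluing × SimpleGraph V × Set V)} {u v : V} :
    (gluedGraph G l).Adj u v ↔ G.Adj u v ∨ ∃ x ∈ l, x.2.1.Adj u v := by
  induction l generalizing G with
  | nil => simp [gluedGraph]
  | cons x l ih =>
    rw [gluedGraph, ih]
    simp [or_assoc]

theorem gluedGraph_copies (n : ℕ) :
    gluedGraph ⊥ ((Gluing.sixCopies.zip copyPlaces).map fun x =>
      (x.1, copyGraph n x.2, copyRegion n x.2)) = sgEdges 3 (n + 1) := by
  have hmem : ∀ p, p ∈ sgCopies 3 ↔ p ∈ copyPlaces := by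
    have h : sgCopies 3 = copyPlaces.toFinset := by decide
    intro p
    rw [h, List.mem_toFinset]
  ext u v
  rw [gluedGraph_adj, sgEdges]
  simp only [SimpleGraph.iSup_adj, hmem, SimpleGraph.bot_adj, false_or]
  simp [Gluing.sixCopies, copyPlaces, copyGraph]

theorem IsDistribution.succ {n : ℕ} {w : Fin 4 → ℕ} (hw : IsDistribution n w) :
    IsDistribution (n + 1) (recPoly w) := by
  rw [isDistribution_iff]
  intro q hq
  have hinj : Set.InjOn (fun u => 3 ^ n • slotPlace u) {u | u < 10} := by
    intro u hu v hv huv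
    have h : ∀ u < 10, ∀ v < 10, slotPlace u = slotPlace v → u = v := by decide
    exact h u hu v hv (smul_right_injective (ℕ × ℕ) (r := 3 ^ n) (by positivity) huv)
  have hchain := isGluingChain_of_chainFits hw (Gluing.sixCopies.zip copyPlaces) (ps := [])
    (L := []) (by decide +kernel) (G := ⊥) (W := ∅) (fun u v h => h.elim) (by simp)
  have h := hchain.ncard_sixCopies hinj hq rfl (by
    rw [gluedGraph_copies]
    exact finite_setOf_isAcyclicOrientation (finite_setOf_sgEdges_adj 3 (n + 1)))
  rw [gluedGraph_copies] at h
  rw [← h]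
  have hc : (fun a => 3 ^ (n + 1) • cornerDir a) =
      (fun u => 3 ^ n • slotPlace u) ∘ Gluing.outer.corner := by
    have h : ∀ a, slotPlace (Gluing.outer.corner a) = 3 • cornerDir a := by decide
    funext a
    rw [Function.comp_apply, h, smul_smul, pow_succ]
  rw [hc]

theorem exists_isDistribution (n : ℕ) : ∃ w, IsDistribution n w := by
  induction n with
  | zero => exact ⟨_, isDistribution_zero⟩
  | succ n ih => exact ih.imp' _ fun _ h => h.succ

/-! ### The five numbers -/

theorem hasOrder_vec_iff {V : Type*} {D : Digraph V} (hD : ∀ v, ¬ HasPath D v v) (x y z : V)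
    (q : List (Fin 3 × Fin 3)) (hq : ∀ a, (a, a) ∉ q) : HasOrder D ![x, y, z] q ↔
      ((HasPath D x y ↔ (0, 1) ∈ q) ∧ (HasPath D x z ↔ (0, 2) ∈ q)) ∧
      ((HasPath D y x ↔ (1, 0) ∈ q) ∧ (HasPath D y z ↔ (1, 2) ∈ q)) ∧
      ((HasPath D z x ↔ (2, 0) ∈ q) ∧ (HasPath D z y ↔ (2, 1) ∈ q)) := by
  simp [HasOrder, Fin.forall_fin_succ, hD, hq]

theorem IsDistribution.sgA_eq {n : ℕ} {w : Fin 4 → ℕ} (hw : IsDistribution n w) :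
    sgA 3 n = w 0 := by
  rw [← hw ([(0, 1), (1, 2), (0, 2)], 0) (by decide), sgA]
  congr 1
  ext D
  refine and_congr_right fun hD => ?_
  rw [hasOrder_vec_iff hD.2 _ _ _ _ (by decide)]
  -- The order also prescribes which paths are absent. Acyclicity excludes the reverses of the paths
  -- that exist.
  have h1 := fun h h' => hD.2 _ (TransGen.trans (a := sgRight 3 n) (b := sgTop 3 n) h h')
  have h2 := fun h h' => hD.2 _ (TransGen.trans (a := sgRight 3 n) (b := sgLeft 3 n) h h')
  have h3 := fun h h' => hD.2 _ (TransGen.trans (a := sgTop 3 n) (b := sgLeft 3 n) h h')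
  simp only [← HasPath.eq_def] at h1 h2 h3
  simp
  tauto

theorem IsDistribution.sgB_eq {n : ℕ} {w : Fin 4 → ℕ} (hw : IsDistribution n w) :
    sgB 3 n = w 1 := by
  rw [← hw ([(0, 1), (0, 2)], 1) (by decide), sgB]
  congr 1
  ext D
  refine and_congr_right fun hD => ?_
  rw [hasOrder_vec_iff hD.2 _ _ _ _ (by decide)]
  have h1 := fun h h' => hD.2 _ (TransGen.trans (a := sgRight 3 n) (b := sgTop 3 n) h h')
  have h2 := fun h h' => hD.2 _ (TransGen.trans (a := sgRight 3 n) (b := sgLeft 3 n) h h')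
  simp only [← HasPath.eq_def] at h1 h2
  simp [NoPathBetween]
  tauto

theorem IsDistribution.sgC_eq {n : ℕ} {w : Fin 4 → ℕ} (hw : IsDistribution n w) :
    sgC 3 n = w 2 := by
  rw [← hw ([(0, 2)], 2) (by decide), sgC]
  congr 1
  ext D
  refine and_congr_right fun hD => ?_
  rw [hasOrder_vec_iff hD.2 _ _ _ _ (by decide)]
  have h2 := fun h h' => hD.2 _ (TransGen.trans (a := sgRight 3 n) (b := sgLeft 3 n) h h')
  simp only [← HasPath.eq_def] at h2
  simp [NoPathBetween]
  tauto

theorem IsDistribution.sgD_eq {n : ℕ} {w : Fin 4 → ℕ} (hw : IsDistribution n w) :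
    sgD 3 n = w 3 := by
  rw [← hw ([], 3) (by decide), sgD]
  congr 1
  ext D
  refine and_congr_right fun hD => ?_
  rw [hasOrder_vec_iff hD.2 _ _ _ _ (by decide)]
  simp [NoPathBetween]
  tauto

/-- Among the nineteen orders there are six chains, six vees or wedges, six single pairs and one
antichain. -/
theorem IsDistribution.sgF_eq {n : ℕ} {w : Fin 4 → ℕ} (hw : IsDistribution n w) :
    sgF 3 n = 6 * w 0 + 6 * w 1 + 6 * w 2 + w 3 := by
  have hfin : {D | IsAcyclicOrientation (SG 3 n) D}.Finite :=
    finite_setOf_isAcyclicOrientation (Set.toFinite _)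
  rw [sgF, numAO, Set.ncard_eq_toFinset_card _ hfin, Finset.card_eq_sum_ones,
    sum_eq_sum_cornerOrders _ (fun D hD => ((Set.Finite.mem_toFinset _).1 hD).2)
      ![sgRight 3 n, sgTop 3 n, sgLeft 3 n] _ (fun _ => 1) (fun _ _ _ _ _ => rfl)]
  have h : (cornerOrders.map fun q => {D | D ∈ hfin.toFinset ∧
      HasOrder D ![sgRight 3 n, sgTop 3 n, sgLeft 3 n] q.1}.ncard * 1) =
      cornerOrders.map fun q => w q.2 := by
    refine List.map_congr_left fun q hq => ?_
    rw [← hw q hq, mul_one]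
    simp only [Set.Finite.mem_toFinset]
    rfl
  rw [h]
  simp only [cornerOrders, List.map_cons, List.map_nil, List.sum_cons, List.sum_nil]
  ring

/-- Given `f = 6a + 6b + 6c + d` at both stages, the recursion for f is a polynomial consequence of
the other four. -/
theorem sgRecF_eq (a b c d : ℕ) :
    sgRecF ((6 * a + 6 * b + 6 * c + d : ℕ) : ℤ) a b c d =
      ((6 * sgRecA a b c d + 6 * sgRecB a b c d + 6 * sgRecC a b c d + sgRecD a b c d : ℕ) : ℤ) := by
  simp only [sgRecF, sgRecA, sgRecB, sgRecC, sgRecD]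
  push_cast
  ring

theorem mainTheorem6 (n : ℕ) :
    (sgF 3 (n + 1) : ℤ) =
      sgRecF (sgF 3 n) (sgA 3 n) (sgB 3 n) (sgC 3 n) (sgD 3 n) ∧
    sgA 3 (n + 1) = sgRecA (sgA 3 n) (sgB 3 n) (sgC 3 n) (sgD 3 n) ∧
    sgB 3 (n + 1) = sgRecB (sgA 3 n) (sgB 3 n) (sgC 3 n) (sgD 3 n) ∧
    sgC 3 (n + 1) = sgRecC (sgA 3 n) (sgB 3 n) (sgC 3 n) (sgD 3 n) ∧
    sgD 3 (n + 1) = sgRecD (sgA 3 n) (sgB 3 n) (sgC 3 n) (sgD 3 n) := by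
  obtain ⟨w, hw⟩ := exists_isDistribution n
  have hw' := hw.succ
  rw [hw.sgA_eq, hw.sgB_eq, hw.sgC_eq, hw.sgD_eq, hw.sgF_eq, hw'.sgA_eq, hw'.sgB_eq, hw'.sgC_eq,
    hw'.sgD_eq, hw'.sgF_eq, sgRecF_eq]
  exact ⟨rfl, rfl, rfl, rfl, rfl⟩
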